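/- Let $X$ be a (real) Hausdorff locally convex topological vector space and let $\hat A\colon \mathcal D(\hat A)\subset X\to X$ be a linear operator, defined on a linear subspace $\mathcal D(\hat A)$ of $X$. Definitions. A family $\{f_\iota\colon X\to X\}_{\iota\in I}$ is sequentially equicontinuous if for every sequence $x_n\to x$ in $X$ and every neighbourhood $U$ of $0$ there is $\bar n$ such that $f_\iota(x_n)\in f_\iota(x)+U$ for all $\iota\in I$ and all $n\ge\bar n$. A $C_0$-sequentially equicontinuous semigroup on $X$ is a family $T=\{T_t\}_{t\ge 0}$ of linear operators $X\to X$ with $T_0=I$, $T_{t+s}=T_tT_s$ for all $t,s\geq 0$, $\lim_{t\to0^+}T_tx=x$ for every $x\in X$, which is sequentially equicontinuous. Its infinitesimal generator is the operator $Ax=\lim_{h\to0^+}(T_hx-x)/h$, whose domain is the set of all $x$ for which this limit exists in $X$. The resolvent set $\rho_0(\hat A)$ is the set of $\lambda\in\mathbb R$ for which $\lambda-\hat A\colon\mathcal D(\hat A)\to X$ is bijective with sequentially continuous inverse $R(\lambda,\hat A)=(\lambda-\hat A)^{-1}\colon X\to X$. The operator $\hat A$ is sequentially closed if its graph is sequentially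 closed in $X\times X$. A set $S\subset X$ is sequentially dense if every point of $X$ is the limit of a sequence in $S$. Finally, $T$ satisfies condition (L) if for every $x\in X$ and $\lambda>0$ the generalized Riemann integral $\int_0^{+\infty}e^{-\lambda t}T_tx\,dt$ exists in $X$, that is, the Riemann integrals $\int_0^{a}e^{-\lambda t}T_tx\,dt$ exist in $X$ for all $a\ge0$ and converge in $X$ as $a\to+\infty$. Consider the two statements: (i) $\hat A$ is the infinitesimal generator of a $C_0$-sequentially equicontinuous semigroup $\hat T$ on $X$; (ii) $\hat A$ is sequentially closed, $\mathcal D(\hat A)$ is sequentially dense in $X$, and there is a sequence $\{\lambda_n\}_{n\in\mathbb N}\subset\rho_0(\hat A)$ with $\lambda_n\to+\infty$ such that the family $\{(\lambda_nR(\lambda_n,\hat A))^m\}_{n,m\in\mathbb N}$ is sequentially equicontinuous. Theorem. If (i) holds with a semigroup $\hat T$ satisfying (L), then (ii) holds. If $X$ is sequentially complete, then (i) and (ii) are equivalent (without assuming (L)). -/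

import Mathlib

open Filter Topology
open scoped NNReal

noncomputable section

namespace SeqSemigroup

section Families

variable {ι X Y : Type*} [TopologicalSpace X] [TopologicalSpace Y] [AddCommGroup Y]

/-- A family of functions `f i : X → Y` is sequentially equicontinuous if, whenever `u n → x` in `X`
and `U` is a neighbourhood of `0` in `Y`, there is `N` such that `f i (u n) ∈ f i x + U` for every
index `i` and every `n ≥ N`. -/
def SeqEquicontinuous (f : ι → X → Y) : Prop :=
  ∀ (x : X) (u : ℕ → X), Tendsto u atTop (𝓝 x) →
    ∀ U ∈ 𝓝 (0 : Y), ∃ N : ℕ, ∀ i : ι, ∀ n ≥ N, f i (u n) - f i x ∈ U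

/-- `s` is sequentially dense: every point is the limit of a sequence in `s`. -/
def SeqDense (s : Set X) : Prop :=
  ∀ x : X, ∃ u : ℕ → X, (∀ n, u n ∈ s) ∧ Tendsto u atTop (𝓝 x)

end Families

/-- Sequential completeness: every Cauchy sequence converges. -/
def SeqComplete (X : Type*) [UniformSpace X] : Prop :=
  ∀ u : ℕ → X, CauchySeq u → ∃ x : X, Tendsto u atTop (𝓝 x)

variable {X : Type*} [AddCommGroup X] [Module ℝ X]

/-- The operator `l - C`, defined on the domain of `C`. -/
def shifted (C : X →ₗ.[ℝ] X) (l : ℝ) : C.domain →ₗ[ℝ] X :=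
  l • C.domain.subtype - C.toFun

open Classical in
/-- `R(l, C) = (l - C)⁻¹`, as a linear operator from `X` to `X`
(with the value `0` when `l - C` is not a bijection from the domain of `C` onto `X`). -/
def resolventOp (C : X →ₗ.[ℝ] X) (l : ℝ) : X →ₗ[ℝ] X :=
  if h : Function.Bijective (shifted C l) then
    C.domain.subtype ∘ₗ (LinearEquiv.ofBijective (shifted C l) h).symm.toLinearMap
  else 0

variable [TopologicalSpace X]

/-- The spectrum `σ₀(C)`: the real `l` such that `l - C` is not one-to-one, or is not onto, or is
invertible with an inverse that is not sequentially continuous. -/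
def spectrum₀ (C : X →ₗ.[ℝ] X) : Set ℝ :=
  {l | ¬ Function.Injective (shifted C l) ∨
    Set.range (shifted C l) ≠ Set.univ ∨
    (Function.Bijective (shifted C l) ∧ ¬ SeqContinuous (resolventOp C l))}

/-- The resolvent set `ρ₀(C) = ℝ ∖ σ₀(C)`. -/
def resolventSet₀ (C : X →ₗ.[ℝ] X) : Set ℝ := (spectrum₀ C)ᶜ

/-- `C` is sequentially closed: its graph is sequentially closed in `X × X`. -/
def IsSeqClosedOp (C : X →ₗ.[ℝ] X) : Prop :=
  IsSeqClosed (C.graph : Set (X × X))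

/-- `T` is a `C₀`-sequentially equicontinuous semigroup on `X`. -/
structure IsC0SeqEquicontinuous (T : ℝ≥0 → X →ₗ[ℝ] X) : Prop where
  zero : T 0 = LinearMap.id
  add : ∀ t s : ℝ≥0, T (t + s) = T t ∘ₗ T s
  tendsto_zero : ∀ x : X, Tendsto (fun t : ℝ≥0 => T t x) (𝓝[>] 0) (𝓝 x)
  seqEquicontinuous : SeqEquicontinuous (fun (t : ℝ≥0) (x : X) => T t x)

/-- `A` is the infinitesimal generator of `T`: its domain is the set of `x` for which
`(T h x - x) / h` has a limit in `X` as `h → 0⁺`, and `A x` is this limit. -/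
structure IsInfinitesimalGenerator (A : X →ₗ.[ℝ] X) (T : ℝ≥0 → X →ₗ[ℝ] X) : Prop where
  mem_domain_iff : ∀ x : X, x ∈ A.domain ↔
    ∃ y : X, Tendsto (fun h : ℝ≥0 => (h : ℝ)⁻¹ • (T h x - x)) (𝓝[>] 0) (𝓝 y)
  tendsto_apply : ∀ x : A.domain,
    Tendsto (fun h : ℝ≥0 => (h : ℝ)⁻¹ • (T h (x : X) - (x : X))) (𝓝[>] 0) (𝓝 (A x))

/-- `y` is the Riemann integral of `f` over `[a, b]`: the Riemann sums over tagged partitions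
`a = t 0 ≤ t 1 ≤ ⋯ ≤ t n = b` with tags `s i ∈ [t i, t (i + 1)]` converge to `y` as the mesh
tends to `0`. -/
def HasRiemannIntegral (f : ℝ → X) (a b : ℝ) (y : X) : Prop :=
  ∀ U ∈ 𝓝 y, ∃ δ > (0 : ℝ), ∀ (n : ℕ) (t s : ℕ → ℝ), t 0 = a → t n = b →
    (∀ i < n, t i ≤ s i ∧ s i ≤ t (i + 1) ∧ t (i + 1) - t i < δ) →
      ∑ i ∈ Finset.range n, (t (i + 1) - t i) • f (s i) ∈ U

/-- For all `x` and `l > 0`, the generalized Riemann integral `∫₀^∞ e^{-lt} T_t x dt` exists in `X`: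
the Riemann integrals over all `[0, a]` exist in `X` and converge in `X` as `a → ∞`. -/
def HasLaplaceTransform (T : ℝ≥0 → X →ₗ[ℝ] X) : Prop :=
  ∀ (x : X) (l : ℝ), 0 < l → ∃ F : ℝ → X,
    (∀ a ≥ 0, HasRiemannIntegral (fun t : ℝ => Real.exp (-l * t) • T t.toNNReal x) 0 a (F a)) ∧
    ∃ y : X, Tendsto F atTop (𝓝 y)

/-- `A` is sequentially closed, has sequentially dense domain, and there is a sequence `l n → +∞` in
`ρ₀(A)` for which the family of all `(l n R(l n, A)) ^ m` is sequentially equicontinuous. -/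
structure HilleYosidaCondition (A : X →ₗ.[ℝ] X) : Prop where
  seqClosed : IsSeqClosedOp A
  seqDense : SeqDense (A.domain : Set X)
  exists_seq : ∃ l : ℕ → ℝ, (∀ n, l n ∈ resolventSet₀ A) ∧ Tendsto l atTop atTop ∧
    SeqEquicontinuous
      (fun (p : ℕ × ℕ) (x : X) => ((l p.1 • resolventOp A (l p.1) : Module.End ℝ X) ^ p.2) x)

end SeqSemigroup

end

/-! Everything is measured by seminorms `q` that are only sequentially continuous. For a
sequentially equicontinuous family of linear maps and a continuous seminorm `p`, the supremum of `p`
along the family is such a seminorm (`SeqEquicontinuous.exists_seminorm`). Over a semigroup it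
dominates `p` and is contracted by every `T t`, so Banach space contraction arguments apply to it.

From (i) to (ii): under (L) the resolvent is the Laplace transform of the semigroup
(`exists_laplace_resolvent`). Hence `q (l • R x) ≤ q x` for all `l > 0`, and one `q` bounds all
powers at once. In a sequentially complete space (L) is automatic: Riemann sums are compared with
scalar integrals through norming functionals, and the factor `exp (-l * t)` makes the tails small.

From (ii) to (i): with `σ n = (l n)⁻¹`, the operator `l n • R (l n)` is an implicit Euler step `(1 -
σ n A)⁻¹`. Equicontinuity of all powers allows a renorming in which `A` is dissipative
(`exists_dissipative_seminorm`). An estimate of Crandall–Liggett and Kobayashi type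
(`IsEulerStep.pow_sub_pow_le`) shows that `J n ^ k n` converges pointwise whenever `k n * σ n → t`.
The limits form a contractive semigroup for each `q`, and its generator is exactly `A`, because `1 -
σ 0 • A` is onto and a contraction semigroup has no exponentially growing mode. -/

set_option linter.unusedSectionVars false

namespace SeqSemigroup

/-! ### Sequentially continuous seminorms. -/

section Seminorms

variable {X : Type*} [AddCommGroup X] [Module ℝ X] [TopologicalSpace X]

theorem seminorm_sum_le (p : Seminorm ℝ X) {ι : Type*} (s : Finset ι) (g : ι → X) :
    p (∑ i ∈ s, g i) ≤ ∑ i ∈ s, p (g i) :=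
  Finset.le_sum_of_subadditive p (map_zero p).le (map_add_le_add p) s g

/-- A seminorm is sequentially continuous if it maps null sequences to null sequences. -/
def SeqContSeminorm (p : Seminorm ℝ X) : Prop :=
  ∀ u : ℕ → X, Tendsto u atTop (𝓝 0) → Tendsto (fun n => p (u n)) atTop (𝓝 0)

theorem SeqContSeminorm.of_continuous {p : Seminorm ℝ X} (hp : Continuous p) :
    SeqContSeminorm p := fun u hu => by
  have h := (hp.tendsto 0).comp hu
  rwa [map_zero] at h

/-- Convergence along a countably generated filter is tested on sequences. This covers the limits `t
→ 0⁺` and `a → ∞` needed for semigroups. -/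
theorem SeqContSeminorm.tendsto_zero {p : Seminorm ℝ X} (hp : SeqContSeminorm p) {α : Type*}
    {l : Filter α} [l.IsCountablyGenerated] {f : α → X} (hf : Tendsto f l (𝓝 0)) :
    Tendsto (fun a => p (f a)) l (𝓝 0) :=
  tendsto_of_seq_tendsto fun u hu => hp (f ∘ u) (hf.comp hu)

section

variable [IsTopologicalAddGroup X]

theorem SeqContSeminorm.tendsto_sub {p : Seminorm ℝ X} (hp : SeqContSeminorm p) {α : Type*}
    {l : Filter α} [l.IsCountablyGenerated] {f : α → X} {x : X} (hf : Tendsto f l (𝓝 x)) :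
    Tendsto (fun a => p (f a - x)) l (𝓝 0) :=
  hp.tendsto_zero (tendsto_sub_nhds_zero_iff.2 hf)

theorem SeqContSeminorm.tendsto {p : Seminorm ℝ X} (hp : SeqContSeminorm p) {α : Type*}
    {l : Filter α} [l.IsCountablyGenerated] {f : α → X} {x : X} (hf : Tendsto f l (𝓝 x)) :
    Tendsto (fun a => p (f a)) l (𝓝 (p x)) := by
  rw [tendsto_iff_norm_sub_tendsto_zero]
  exact squeeze_zero (fun _ => norm_nonneg _) (fun a => p.norm_sub_map_le_sub (f a) x)
    (hp.tendsto_sub hf)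

theorem SeqContSeminorm.le_of_tendsto {p : Seminorm ℝ X} (hp : SeqContSeminorm p) {α : Type*}
    {l : Filter α} [l.IsCountablyGenerated] [l.NeBot] {f : α → X} {x : X} {c : ℝ}
    (hf : Tendsto f l (𝓝 x)) (h : ∀ᶠ a in l, p (f a) ≤ c) : p x ≤ c :=
  _root_.le_of_tendsto (hp.tendsto hf) h

end

/-- The supremum of `p ∘ f i` over a sequentially equicontinuous family of linear maps. -/
theorem SeqEquicontinuous.exists_seminorm [ContinuousSMul ℝ X] {ι : Type*} [Nonempty ι]
    {f : ι → X →ₗ[ℝ] X} (hf : SeqEquicontinuous fun i x => f i x) {p : Seminorm ℝ X}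
    (hp : Continuous p) :
    ∃ q : Seminorm ℝ X, SeqContSeminorm q ∧ (∀ i x, p (f i x) ≤ q x) ∧
      ∀ x c, (∀ i, p (f i x) ≤ c) → q x ≤ c := by
  have hev : ∀ u : ℕ → X, Tendsto u atTop (𝓝 0) → ∀ ε > 0, ∃ N, ∀ i, ∀ n ≥ N,
      p (f i (u n)) < ε := by
    intro u hu ε hε
    obtain ⟨N, hN⟩ := hf 0 u hu _ (Seminorm.ball_mem_nhds hp hε)
    refine ⟨N, fun i n hn => ?_⟩
    simpa using hN i n hn
  have hb : BddAbove (Set.range fun i => p.comp (f i)) := by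
    -- Pointwise boundedness comes from testing equicontinuity on the null sequence `x / (n + 1)`:
    -- one index `N` serves all `i`, so `p (f i x) ≤ N + 1`.
    refine Seminorm.bddAbove_range_iff.2 fun x => ?_
    have hx : Tendsto (fun n : ℕ => ((n : ℝ) + 1)⁻¹ • x) atTop (𝓝 0) := by
      have h := (tendsto_one_div_add_atTop_nhds_zero_nat (𝕜 := ℝ)).smul_const x
      simpa using h
    obtain ⟨N, hN⟩ := hev _ hx 1 one_pos
    refine ⟨(N : ℝ) + 1, ?_⟩
    rintro _ ⟨i, rfl⟩
    have h := hN i N le_rfl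
    have hpos : (0 : ℝ) < (N : ℝ) + 1 := by positivity
    rw [map_smul, map_smul_eq_mul, Real.norm_of_nonneg (by positivity),
      inv_mul_lt_iff₀ hpos, mul_one] at h
    exact h.le
  have happ : ∀ x, (⨆ i, p.comp (f i)) x = ⨆ i, p (f i x) := fun x => by
    rw [Seminorm.iSup_apply hb]; rfl
  refine ⟨⨆ i, p.comp (f i), ?_, ?_, ?_⟩
  · intro u hu
    rw [Metric.tendsto_atTop]
    intro ε hε
    obtain ⟨N, hN⟩ := hev u hu (ε / 2) (half_pos hε)
    refine ⟨N, fun n hn => ?_⟩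
    rw [Real.dist_eq, sub_zero, abs_of_nonneg (apply_nonneg _ _), happ]
    exact (ciSup_le fun i => (hN i n hn).le).trans_lt (half_lt_self hε)
  · intro i x
    rw [happ]
    exact le_ciSup (Seminorm.bddAbove_range_iff.1 hb x) i
  · intro x c h
    rw [happ]
    exact ciSup_le h

variable [IsTopologicalAddGroup X] [ContinuousSMul ℝ X] [LocallyConvexSpace ℝ X]

theorem tendsto_iff_seminorm {α : Type*} {l : Filter α} {f : α → X} {x : X} :
    Tendsto f l (𝓝 x) ↔ ∀ p : Seminorm ℝ X, Continuous p → ∀ ε > 0, ∀ᶠ a in l, p (f a - x) < ε := by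
  rw [(PolynormableSpace.withSeminorms ℝ X).tendsto_nhds]
  exact ⟨fun h p hp => h ⟨p, hp⟩, fun h p => h p.1 p.2⟩

theorem exists_seminorm_of_mem_nhds {x : X} {U : Set X} (hU : U ∈ 𝓝 x) :
    ∃ p : Seminorm ℝ X, Continuous p ∧ ∃ ε > 0, ∀ y, p (y - x) < ε → y ∈ U := by
  obtain ⟨s, r, hr, h⟩ := ((PolynormableSpace.withSeminorms ℝ X).mem_nhds_iff x U).1 hU
  refine ⟨s.sup fun p => p.1, ?_, r, hr, fun y hy => h (by simpa [Seminorm.mem_ball] using hy)⟩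
  exact Seminorm.continuous_finsetSup fun i _ => i.2

theorem eq_of_forall_seminorm [T2Space X] {x y : X}
    (h : ∀ p : Seminorm ℝ X, Continuous p → p (x - y) = 0) : x = y := by
  have : Tendsto (fun _ : ℕ => x) atTop (𝓝 y) :=
    tendsto_iff_seminorm.2 fun p hp ε hε => Eventually.of_forall fun _ => by rwa [h p hp]
  exact tendsto_nhds_unique tendsto_const_nhds this

theorem seqEquicontinuous_of_seminorm {ι : Type*} {f : ι → X →ₗ[ℝ] X}
    (h : ∀ p : Seminorm ℝ X, Continuous p →
      ∃ q : Seminorm ℝ X, SeqContSeminorm q ∧ ∀ i x, p (f i x) ≤ q x) :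
    SeqEquicontinuous fun i x => f i x := by
  intro x u hu U hU
  obtain ⟨p, hp, ε, hε, hpU⟩ := exists_seminorm_of_mem_nhds hU
  obtain ⟨q, hq, hpq⟩ := h p hp
  obtain ⟨N, hN⟩ := eventually_atTop.1 ((hq.tendsto_sub hu).eventually_lt_const hε)
  refine ⟨N, fun i n hn => hpU _ ?_⟩
  rw [sub_zero, ← map_sub]
  exact (hpq i _).trans_lt (hN n hn)

theorem seqContinuous_of_seminorm {f : X →ₗ[ℝ] X}
    (h : ∀ p : Seminorm ℝ X, Continuous p →
      ∃ q : Seminorm ℝ X, SeqContSeminorm q ∧ ∃ c : ℝ, ∀ x, p (f x) ≤ c * q x) :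
    SeqContinuous f := by
  intro u x hu
  refine tendsto_iff_seminorm.2 fun p hp ε hε => ?_
  obtain ⟨q, hq, c, hpq⟩ := h p hp
  have hlim := (hq.tendsto_sub hu).const_mul c
  rw [mul_zero] at hlim
  filter_upwards [hlim.eventually_lt_const hε] with n hn
  simp only [Function.comp_apply, ← map_sub]
  exact (hpq _).trans_lt hn

end Seminorms

theorem _root_.SeqContinuous.tendsto {X Y : Type*} [TopologicalSpace X] [TopologicalSpace Y]
    {f : X → Y} (hf : SeqContinuous f) {α : Type*} {l : Filter α} [l.IsCountablyGenerated]
    {g : α → X} {x : X} (hg : Tendsto g l (𝓝 x)) : Tendsto (fun a => f (g a)) l (𝓝 (f x)) :=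
  tendsto_of_seq_tendsto fun _ hu => hf (hg.comp hu)

theorem cauchySeq_of_seminorm {X : Type*} [AddCommGroup X] [Module ℝ X] [UniformSpace X]
    [IsUniformAddGroup X] [ContinuousSMul ℝ X] [LocallyConvexSpace ℝ X] {u : ℕ → X}
    (h : ∀ p : Seminorm ℝ X, Continuous p → ∀ ε > 0, ∃ N, ∀ m ≥ N, ∀ n ≥ N, p (u m - u n) < ε) :
    CauchySeq u := by
  rw [cauchySeq_iff]
  intro V hV
  rw [uniformity_eq_comap_nhds_zero, mem_comap] at hV
  obtain ⟨U, hU, hUV⟩ := hV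
  obtain ⟨p, hp, ε, hε, hpU⟩ := exists_seminorm_of_mem_nhds hU
  obtain ⟨N, hN⟩ := h p hp ε hε
  exact ⟨N, fun m hm n hn => hUV (hpU _ (by simpa using hN n hn m hm))⟩

/-! ### Algebra of the resolvent. -/

section Resolvent

variable {X : Type*} [AddCommGroup X] [Module ℝ X]

theorem shifted_apply (C : X →ₗ.[ℝ] X) (l : ℝ) (x : C.domain) :
    shifted C l x = l • (x : X) - C x := rfl

theorem exists_resolventOp_eq {C : X →ₗ.[ℝ] X} {l : ℝ} (h : Function.Bijective (shifted C l))
    (x : X) : ∃ y : C.domain, resolventOp C l x = y ∧ shifted C l y = x := by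
  refine ⟨(LinearEquiv.ofBijective (shifted C l) h).symm x, ?_, ?_⟩
  · simp [resolventOp, h]
  · exact (LinearEquiv.ofBijective (shifted C l) h).apply_symm_apply x

theorem resolventOp_shifted {C : X →ₗ.[ℝ] X} {l : ℝ} (h : Function.Bijective (shifted C l))
    (x : C.domain) : resolventOp C l (shifted C l x) = x := by
  obtain ⟨y, hy, hxy⟩ := exists_resolventOp_eq h (shifted C l x)
  rw [hy, h.1 hxy]

theorem mem_resolventSet₀_iff [TopologicalSpace X] {C : X →ₗ.[ℝ] X} {l : ℝ} :
    l ∈ resolventSet₀ C ↔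
      Function.Bijective (shifted C l) ∧ SeqContinuous (resolventOp C l) := by
  simp only [resolventSet₀, spectrum₀, Set.mem_compl_iff, Set.mem_ofPred_eq, not_or, not_not,
    not_and, ne_eq, Set.range_eq_univ]
  exact ⟨fun h => ⟨⟨h.1, h.2.1⟩, h.2.2 ⟨h.1, h.2.1⟩⟩, fun h => ⟨h.1.1, h.1.2, fun _ => h.2⟩⟩

/-- The graph of `C` is the set of `(x, y)` with `x = R (l x - y)`, a condition that survives limits
of sequences. -/
theorem isSeqClosedOp_of_mem_resolventSet₀ [TopologicalSpace X] [IsTopologicalAddGroup X]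
    [ContinuousSMul ℝ X] [T2Space X] {C : X →ₗ.[ℝ] X} {l : ℝ} (hl : l ∈ resolventSet₀ C) :
    IsSeqClosedOp C := by
  obtain ⟨hb, hc⟩ := mem_resolventSet₀_iff.1 hl
  intro u z hu huz
  have h1 : Tendsto (fun n => (u n).1) atTop (𝓝 z.1) := (continuous_fst.tendsto z).comp huz
  have h2 : Tendsto (fun n => (u n).2) atTop (𝓝 z.2) := (continuous_snd.tendsto z).comp huz
  have h3 : Tendsto (fun n => resolventOp C l (l • (u n).1 - (u n).2)) atTop
      (𝓝 (resolventOp C l (l • z.1 - z.2))) := hc ((h1.const_smul l).sub h2)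
  have h4 : ∀ n, resolventOp C l (l • (u n).1 - (u n).2) = (u n).1 := by
    intro n
    obtain ⟨y, hy1, hy2⟩ := (LinearPMap.mem_graph_iff C).1 (hu n)
    rw [← hy1, ← hy2, ← shifted_apply, resolventOp_shifted hb]
  simp only [h4] at h3
  have h5 := tendsto_nhds_unique h1 h3
  obtain ⟨y, hy, hxy⟩ := exists_resolventOp_eq hb (l • z.1 - z.2)
  refine (LinearPMap.mem_graph_iff C).2 ⟨y, (h5.trans hy).symm, ?_⟩
  rw [shifted_apply, ← hy, ← h5] at hxy
  exact sub_right_injective hxy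

end Resolvent

/-! ### Laplace transforms through uniform Riemann sums. -/

section Laplace

variable {X : Type*} [AddCommGroup X] [Module ℝ X]

/-- The right Riemann sum of `f` over `[0, k * h]` with `n + 1` nodes in each interval of
length `h`. -/
noncomputable def uniformSum (f : ℝ → X) (h : ℝ) (k n : ℕ) : X :=
  ∑ i ∈ Finset.range (k * (n + 1)), (h / (n + 1)) • f ((i + 1) * (h / (n + 1)))

/-- The function `t ↦ e^{-lt} T_t x`. -/
noncomputable def dampedOrbit (T : ℝ≥0 → X →ₗ[ℝ] X) (l : ℝ) (x : X) (t : ℝ) : X :=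
  Real.exp (-l * t) • T t.toNNReal x

/-- The Riemann sums of `f` over tagged partitions of `[a, b]` of mesh less than `δ`. -/
def riemannSums (f : ℝ → X) (a b δ : ℝ) : Set X :=
  {y | ∃ (n : ℕ) (t s : ℕ → ℝ), t 0 = a ∧ t n = b ∧
    (∀ i < n, t i ≤ s i ∧ s i ≤ t (i + 1) ∧ t (i + 1) - t i < δ) ∧
      y = ∑ i ∈ Finset.range n, (t (i + 1) - t i) • f (s i)}

theorem hasRiemannIntegral_iff [TopologicalSpace X] {f : ℝ → X} {a b : ℝ} {y : X} :
    HasRiemannIntegral f a b y ↔ ∀ U ∈ 𝓝 y, ∃ δ > 0, riemannSums f a b δ ⊆ U := by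
  refine forall₂_congr fun U _ => exists_congr fun δ => and_congr_right fun _ => ⟨?_, ?_⟩
  · rintro h _ ⟨n, t, s, h0, hn, H, rfl⟩
    exact h n t s h0 hn H
  · exact fun h n t s h0 hn H => h ⟨n, t, s, h0, hn, H, rfl⟩

theorem uniformSum_mem_riemannSums (f : ℝ → X) {h δ : ℝ} (hh : 0 ≤ h) (k : ℕ) {n : ℕ}
    (hn : h / (n + 1) < δ) : uniformSum f h k n ∈ riemannSums f 0 (k * h) δ := by
  have hn0 : 0 ≤ h / ((n : ℝ) + 1) := by positivity
  have hn1 : (n : ℝ) + 1 ≠ 0 := by positivity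
  refine ⟨k * (n + 1), fun i => i * (h / (n + 1)), fun i => (i + 1) * (h / (n + 1)), by simp,
    by push_cast; field_simp, fun i _ => ⟨by nlinarith, by push_cast; rfl, by
      push_cast; linarith⟩, ?_⟩
  rw [uniformSum]
  congr! 2
  push_cast
  ring

theorem tendsto_div_succ (h : ℝ) : Tendsto (fun n : ℕ => h / ((n : ℝ) + 1)) atTop (𝓝 0) := by
  simpa [div_eq_mul_inv] using
    (tendsto_one_div_add_atTop_nhds_zero_nat (𝕜 := ℝ)).const_mul h

variable [TopologicalSpace X]

theorem HasRiemannIntegral.tendsto_uniformSum {f : ℝ → X} {h : ℝ} (hh : 0 ≤ h) {k : ℕ} {y : X}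
    (hy : HasRiemannIntegral f 0 (k * h) y) :
    Tendsto (fun n => uniformSum f h k n) atTop (𝓝 y) := by
  rw [tendsto_def]
  intro U hU
  obtain ⟨δ, hδ, H⟩ := hasRiemannIntegral_iff.1 hy U hU
  filter_upwards [(tendsto_div_succ h).eventually_lt_const hδ] with n hn
  exact H (uniformSum_mem_riemannSums f hh k hn)

/-- `y = ∫₀^∞ e^{-lt} T_t x dt` and `F a = ∫₀ᵃ e^{-lt} T_t x dt`, where the integrals are taken as
limits of uniform Riemann sums. -/
structure HasUniformLaplace (T : ℝ≥0 → X →ₗ[ℝ] X) (l : ℝ) (x : X) (F : ℝ → X) (y : X) : Prop where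
  integral : ∀ h ≥ 0, ∀ k : ℕ,
    Tendsto (fun n => uniformSum (dampedOrbit T l x) h k n) atTop (𝓝 (F (k * h)))
  limit : Tendsto F atTop (𝓝 y)

theorem HasLaplaceTransform.exists_hasUniformLaplace {T : ℝ≥0 → X →ₗ[ℝ] X}
    (hT : HasLaplaceTransform T) {l : ℝ} (hl : 0 < l) (x : X) :
    ∃ F y, HasUniformLaplace T l x F y := by
  obtain ⟨F, hF, y, hy⟩ := hT x l hl
  exact ⟨F, y, fun h hh k => (hF _ (by positivity)).tendsto_uniformSum hh, hy⟩

/-- Right endpoint sums of a decreasing function stay below its integral; the induction telescopes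
this using `1 + l d ≤ exp (l d)`. -/
theorem sum_exp_le {l : ℝ} (hl : 0 < l) (d : ℝ) (N : ℕ) :
    ∑ i ∈ Finset.range N, d * Real.exp (-l * ((i + 1) * d)) ≤ 1 / l := by
  have key : l * ∑ i ∈ Finset.range N, d * Real.exp (-l * ((i + 1) * d))
      ≤ 1 - Real.exp (-l * (N * d)) := by
    induction N with
    | zero => simp
    | succ N ih =>
      rw [Finset.sum_range_succ, mul_add]
      have h1 : Real.exp (-l * (N * d)) =
          Real.exp (-l * ((N + 1) * d)) * Real.exp (l * d) := by
        rw [← Real.exp_add]; ring_nf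
      have h2 := mul_le_mul_of_nonneg_left (Real.add_one_le_exp (l * d))
        (Real.exp_pos (-l * ((N + 1) * d))).le
      push_cast
      nlinarith
  rw [le_div_iff₀ hl, mul_comm]
  linarith [Real.exp_pos (-l * (N * d))]

section Algebra

variable [IsTopologicalAddGroup X] [ContinuousSMul ℝ X] {T : ℝ≥0 → X →ₗ[ℝ] X} {l : ℝ}
  {x x' y y' : X} {F F' : ℝ → X}

theorem HasUniformLaplace.add (h : HasUniformLaplace T l x F y)
    (h' : HasUniformLaplace T l x' F' y') :
    HasUniformLaplace T l (x + x') (fun a => F a + F' a) (y + y') where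
  integral a ha k := by
    refine ((h.integral a ha k).add (h'.integral a ha k)).congr fun n => ?_
    simp [uniformSum, dampedOrbit, Finset.sum_add_distrib]
  limit := h.limit.add h'.limit

theorem HasUniformLaplace.const_smul (h : HasUniformLaplace T l x F y) (c : ℝ) :
    HasUniformLaplace T l (c • x) (fun a => c • F a) (c • y) where
  integral a ha k := by
    refine ((h.integral a ha k).const_smul c).congr fun n => ?_
    simp only [uniformSum, dampedOrbit, Finset.smul_sum, map_smul]
    exact Finset.sum_congr rfl fun i _ => by rw [smul_comm c, smul_comm c]
  limit := h.limit.const_smul c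

theorem HasUniformLaplace.unique [T2Space X] (h : HasUniformLaplace T l x F y)
    (h' : HasUniformLaplace T l x F' y') : y = y' := by
  have hF : ∀ k : ℕ, F k = F' k := fun k => by
    simpa using tendsto_nhds_unique (h.integral 1 zero_le_one k) (h'.integral 1 zero_le_one k)
  have h1 := h.limit.comp (tendsto_natCast_atTop_atTop (R := ℝ))
  have h2 := h'.limit.comp (tendsto_natCast_atTop_atTop (R := ℝ))
  refine tendsto_nhds_unique h1 (h2.congr fun k => (hF k).symm)

theorem HasUniformLaplace.seminorm_le (h : HasUniformLaplace T l x F y) (hl : 0 < l)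
    {q : Seminorm ℝ X} (hq : SeqContSeminorm q) (hqT : ∀ t x, q (T t x) ≤ q x) :
    q y ≤ q x / l := by
  have hF : ∀ k : ℕ, q (F k) ≤ q x / l := by
    intro k
    have h1 := h.integral 1 zero_le_one k
    rw [mul_one] at h1
    refine hq.le_of_tendsto h1 (Eventually.of_forall fun n => ?_)
    calc q (uniformSum (dampedOrbit T l x) 1 k n)
        ≤ ∑ i ∈ Finset.range (k * (n + 1)),
            q ((1 / (n + 1) : ℝ) • dampedOrbit T l x ((i + 1) * (1 / (n + 1)))) :=
          seminorm_sum_le _ _ _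
      _ ≤ ∑ i ∈ Finset.range (k * (n + 1)),
            (1 / (n + 1) * Real.exp (-l * ((i + 1) * (1 / (n + 1))))) * q x := by
          refine Finset.sum_le_sum fun i _ => ?_
          rw [dampedOrbit, smul_smul, map_smul_eq_mul, Real.norm_of_nonneg (by positivity)]
          exact mul_le_mul_of_nonneg_left (hqT _ _) (by positivity)
      _ ≤ 1 / l * q x := by
          rw [← Finset.sum_mul]
          exact mul_le_mul_of_nonneg_right (sum_exp_le hl _ _) (apply_nonneg _ _)
      _ = q x / l := by ring
  exact hq.le_of_tendsto (h.limit.comp (tendsto_natCast_atTop_atTop (R := ℝ)))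
    (Eventually.of_forall hF)

end Algebra

variable [IsTopologicalAddGroup X] [ContinuousSMul ℝ X] {T : ℝ≥0 → X →ₗ[ℝ] X} {l : ℝ}

theorem IsC0SeqEquicontinuous.seqContinuous (hT : IsC0SeqEquicontinuous T) (t : ℝ≥0) :
    SeqContinuous (T t) := by
  intro u x hu
  rw [← tendsto_sub_nhds_zero_iff, tendsto_def]
  intro U hU
  obtain ⟨N, hN⟩ := hT.seqEquicontinuous x u hu U hU
  filter_upwards [eventually_ge_atTop N] with n hn using hN t n hn

theorem IsC0SeqEquicontinuous.comm (hT : IsC0SeqEquicontinuous T) (s t : ℝ≥0) (x : X) :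
    T s (T t x) = T t (T s x) := by
  rw [← LinearMap.comp_apply, ← hT.add, add_comm, hT.add, LinearMap.comp_apply]

/-- A continuous seminorm is dominated by a sequentially continuous one that `T` contracts. -/
theorem IsC0SeqEquicontinuous.exists_seminorm (hT : IsC0SeqEquicontinuous T) {p : Seminorm ℝ X}
    (hp : Continuous p) : ∃ q : Seminorm ℝ X, SeqContSeminorm q ∧ (∀ x, p x ≤ q x) ∧
      ∀ t x, q (T t x) ≤ q x := by
  obtain ⟨q, hq, h1, h2⟩ := hT.seqEquicontinuous.exists_seminorm hp
  refine ⟨q, hq, fun x => by simpa [hT.zero] using h1 0 x, fun t x => h2 _ _ fun s => ?_⟩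
  rw [← LinearMap.comp_apply, ← hT.add]
  exact h1 _ _

theorem dampedOrbit_add (hT : IsC0SeqEquicontinuous T) (x : X) (h : ℝ≥0) {s : ℝ} (hs : 0 ≤ s) :
    dampedOrbit T l x (h + s) = Real.exp (-l * h) • T h (dampedOrbit T l x s) := by
  have h1 : ((h : ℝ) + s).toNNReal = h + s.toNNReal := by
    rw [Real.toNNReal_add h.coe_nonneg hs, Real.toNNReal_coe]
  rw [dampedOrbit, dampedOrbit, map_smul, smul_smul, ← Real.exp_add, ← mul_add, h1, hT.add,
    LinearMap.comp_apply]

/-- Uniform nodes split exactly at the multiples of `h`, so the semigroup law already holds for the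
sums. Being sequences, the sums have limits that the merely sequentially continuous `T h` respects.
-/
theorem uniformSum_succ (hT : IsC0SeqEquicontinuous T) (x : X) (h : ℝ≥0) (k n : ℕ) :
    uniformSum (dampedOrbit T l x) h (k + 1) n = uniformSum (dampedOrbit T l x) h 1 n +
      Real.exp (-l * h) • T h (uniformSum (dampedOrbit T l x) h k n) := by
  rw [uniformSum, uniformSum, uniformSum, add_mul, add_comm (k * (n + 1)), Finset.sum_range_add,
    map_sum, Finset.smul_sum]
  congr 1
  refine Finset.sum_congr rfl fun i _ => ?_
  have hn : (n : ℝ) + 1 ≠ 0 := by positivity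
  rw [map_smul, smul_comm, ← dampedOrbit_add hT x h (by positivity)]
  congr 2
  push_cast
  field_simp
  ring

theorem HasUniformLaplace.map (hT : IsC0SeqEquicontinuous T) {x y : X} {F : ℝ → X}
    (h : HasUniformLaplace T l x F y) (s : ℝ≥0) :
    HasUniformLaplace T l (T s x) (fun a => T s (F a)) (T s y) where
  integral a ha k := by
    refine ((hT.seqContinuous s).tendsto (h.integral a ha k)).congr fun n => ?_
    rw [uniformSum, uniformSum, map_sum]
    exact Finset.sum_congr rfl fun i _ => by
      rw [map_smul, dampedOrbit, dampedOrbit, map_smul, hT.comm]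
  limit := (hT.seqContinuous s).tendsto h.limit

/-- Splits `∫₀^∞` at `s` and shifts the tail back to `0`. This identity differentiates `T` along the
range of the resolvent. -/
theorem HasUniformLaplace.apply_eq [T2Space X] (hT : IsC0SeqEquicontinuous T) {x y : X}
    {F : ℝ → X} (h : HasUniformLaplace T l x F y) {s : ℝ≥0} (hs : 0 < s) :
    y = F s + Real.exp (-l * s) • T s y := by
  have hc := hT.seqContinuous s
  have hF : ∀ k : ℕ, F (((k + 1 : ℕ) : ℝ) * s) = F s + Real.exp (-l * s) • T s (F (k * s)) := by
    intro k
    refine tendsto_nhds_unique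
      ((h.integral s s.2 (k + 1)).congr fun n => uniformSum_succ hT x s k n) ?_
    have h1 := h.integral s s.2 1
    rw [Nat.cast_one, one_mul] at h1
    exact h1.add ((hc.tendsto (h.integral s s.2 k)).const_smul _)
  have hs' : (0 : ℝ) < s := hs
  have hlim : Tendsto (fun k : ℕ => F (k * s)) atTop (𝓝 y) :=
    h.limit.comp ((tendsto_natCast_atTop_atTop (R := ℝ)).atTop_mul_const hs')
  have h1 : Tendsto (fun k : ℕ => F (((k + 1 : ℕ) : ℝ) * s)) atTop (𝓝 y) :=
    hlim.comp (tendsto_add_atTop_nat 1)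
  exact tendsto_nhds_unique (h1.congr hF) (((hc.tendsto hlim).const_smul _).const_add _)

theorem tendsto_dampedOrbit (hT : IsC0SeqEquicontinuous T) (l : ℝ) (x : X) :
    Tendsto (fun t : ℝ≥0 => dampedOrbit T l x t) (𝓝[>] 0) (𝓝 x) := by
  have h1 : Tendsto (fun t : ℝ≥0 => Real.exp (-l * t)) (𝓝[>] 0) (𝓝 1) := by
    have : Continuous fun t : ℝ≥0 => Real.exp (-l * t) := by fun_prop
    simpa using (this.tendsto 0).mono_left nhdsWithin_le_nhds
  simpa [dampedOrbit] using h1.smul (hT.tendsto_zero x)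

variable [LocallyConvexSpace ℝ X]

theorem HasUniformLaplace.tendsto_average (hT : IsC0SeqEquicontinuous T) {x y : X} {F : ℝ → X}
    (h : HasUniformLaplace T l x F y) :
    Tendsto (fun s : ℝ≥0 => (s : ℝ)⁻¹ • F s) (𝓝[>] 0) (𝓝 x) := by
  refine tendsto_iff_seminorm.2 fun p hp ε hε => ?_
  have h1 := tendsto_iff_seminorm.1 (tendsto_dampedOrbit hT l x) p hp (ε / 2) (half_pos hε)
  obtain ⟨δ, hδ, hsub⟩ := mem_nhdsGT_iff_exists_Ioo_subset.1 h1
  filter_upwards [Ioo_mem_nhdsGT hδ] with s hs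
  have hs0 : (0 : ℝ) < s := hs.1
  have hbound : p (F s - (s : ℝ) • x) ≤ s * (ε / 2) := by
    have hlim := h.integral s s.2 1
    rw [Nat.cast_one, one_mul] at hlim
    refine (SeqContSeminorm.of_continuous hp).le_of_tendsto (hlim.sub_const _)
      (Eventually.of_forall fun n => ?_)
    have hn : (n : ℝ) + 1 ≠ 0 := by positivity
    have hsum : uniformSum (dampedOrbit T l x) s 1 n - (s : ℝ) • x =
        ∑ i ∈ Finset.range (n + 1), ((s : ℝ) / (n + 1)) •
          (dampedOrbit T l x ((i + 1) * (s / (n + 1))) - x) := by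
      simp only [smul_sub, Finset.sum_sub_distrib, uniformSum, one_mul, Finset.sum_const,
        Finset.card_range]
      rw [← Nat.cast_smul_eq_nsmul ℝ, smul_smul]
      congr 2
      push_cast
      field_simp
    rw [hsum]
    calc _ ≤ ∑ i ∈ Finset.range (n + 1), p (((s : ℝ) / (n + 1)) •
          (dampedOrbit T l x ((i + 1) * (s / (n + 1))) - x)) := seminorm_sum_le _ _ _
      _ ≤ ∑ i ∈ Finset.range (n + 1), (s : ℝ) / (n + 1) * (ε / 2) := by
        refine Finset.sum_le_sum fun i hi => ?_
        rw [map_smul_eq_mul, Real.norm_of_nonneg (by positivity)]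
        refine mul_le_mul_of_nonneg_left ?_ (by positivity)
        have hi' : (i : ℝ) + 1 ≤ n + 1 := by exact_mod_cast Finset.mem_range.1 hi
        -- Right endpoints are strictly positive, as required by a limit at `0⁺` that ignores `0`
        -- itself.
        have hmem : ((i : ℝ≥0) + 1) * (s / (n + 1)) ∈ Set.Ioo 0 δ := by
          have hs1 : 0 < s := hs.1
          refine ⟨by positivity, lt_of_le_of_lt ?_ hs.2⟩
          rw [← NNReal.coe_le_coe]
          push_cast
          rw [mul_div_assoc', div_le_iff₀ (by positivity), mul_comm]
          exact mul_le_mul_of_nonneg_left hi' hs0.le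
        have := hsub hmem
        simp only [Set.mem_ofPred_eq] at this
        push_cast at this
        exact this.le
      _ = s * (ε / 2) := by
        rw [Finset.sum_const, Finset.card_range, nsmul_eq_mul]
        push_cast
        field_simp
  have heq : (s : ℝ)⁻¹ • F s - x = (s : ℝ)⁻¹ • (F s - (s : ℝ) • x) := by
    rw [smul_sub, smul_smul, inv_mul_cancel₀ hs0.ne', one_smul]
  rw [heq, map_smul_eq_mul, Real.norm_of_nonneg (by positivity), inv_mul_lt_iff₀ hs0]
  exact hbound.trans_lt (mul_lt_mul_of_pos_left (half_lt_self hε) hs0)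

end Laplace

/-! ### The resolvent of a generator and the Hille–Yosida bounds. -/

section Generator

variable {X : Type*} [AddCommGroup X] [Module ℝ X] [TopologicalSpace X] [IsTopologicalAddGroup X]
  [ContinuousSMul ℝ X] [T2Space X] {T : ℝ≥0 → X →ₗ[ℝ] X} {A : X →ₗ.[ℝ] X}

theorem IsInfinitesimalGenerator.apply_eq (hA : IsInfinitesimalGenerator A T) {x y : X}
    (h : Tendsto (fun h : ℝ≥0 => (h : ℝ)⁻¹ • (T h x - x)) (𝓝[>] 0) (𝓝 y)) :
    ∃ z : A.domain, (z : X) = x ∧ A z = y :=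
  ⟨⟨x, (hA.mem_domain_iff x).2 ⟨y, h⟩⟩, rfl,
    tendsto_nhds_unique (hA.tendsto_apply ⟨x, (hA.mem_domain_iff x).2 ⟨y, h⟩⟩) h⟩

theorem IsInfinitesimalGenerator.map_mem_domain (hA : IsInfinitesimalGenerator A T)
    (hT : IsC0SeqEquicontinuous T) (s : ℝ≥0) {x : X} (hx : x ∈ A.domain) : T s x ∈ A.domain := by
  obtain ⟨y, hy⟩ := (hA.mem_domain_iff x).1 hx
  refine (hA.mem_domain_iff _).2 ⟨T s y, ((hT.seqContinuous s).tendsto hy).congr fun h => ?_⟩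
  rw [map_smul, map_sub, hT.comm]

/-- The resolvent of the generator is the Laplace transform of the semigroup. -/
theorem exists_laplace_resolvent [LocallyConvexSpace ℝ X] (hT : IsC0SeqEquicontinuous T)
    (hL : HasLaplaceTransform T) (hA : IsInfinitesimalGenerator A T) {l : ℝ} (hl : 0 < l) :
    Function.Bijective (shifted A l) ∧
      ∀ x, ∃ F, HasUniformLaplace T l x F (resolventOp A l x) := by
  choose F R hR using fun x => hL.exists_hasUniformLaplace hl x
  have hadd : ∀ x y, R (x + y) = R x + R y := fun x y => (hR _).unique ((hR x).add (hR y))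
  have hsmul : ∀ (c : ℝ) x, R (c • x) = c • R x := fun c x => (hR _).unique ((hR x).const_smul c)
  let R' : X →ₗ[ℝ] X := { toFun := R, map_add' := hadd, map_smul' := hsmul }
  have hcomm : ∀ s x, R (T s x) = T s (R x) := fun s x => (hR _).unique ((hR x).map hT s)
  -- Since `T h (R x) = exp (l h) • (R x - F x h)`, the quotient equals `((exp (l h) - 1) / h) • R x
  -- - exp (l h) • (F x h / h)`, and the averages `F x h / h` tend to `x`.
  have hderiv : ∀ x, Tendsto (fun h : ℝ≥0 => (h : ℝ)⁻¹ • (T h (R x) - R x)) (𝓝[>] 0)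
      (𝓝 (l • R x - x)) := by
    intro x
    have he : Tendsto (fun h : ℝ≥0 => Real.exp (l * h)) (𝓝[>] 0) (𝓝 1) := by
      have : Continuous fun t : ℝ≥0 => Real.exp (l * t) := by fun_prop
      simpa using (this.tendsto 0).mono_left nhdsWithin_le_nhds
    have hd : Tendsto (fun h : ℝ≥0 => (h : ℝ)⁻¹ * (Real.exp (l * h) - 1)) (𝓝[>] 0) (𝓝 l) := by
      have h1 : HasDerivAt (fun t : ℝ => Real.exp (l * t)) l 0 := by
        simpa using ((hasDerivAt_id (0 : ℝ)).const_mul l).exp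
      have h2 := hasDerivAt_iff_tendsto_slope_zero.1 h1
      simp only [zero_add, mul_zero, Real.exp_zero, smul_eq_mul] at h2
      refine h2.comp (tendsto_nhdsWithin_iff.2 ⟨?_, ?_⟩)
      · simpa using (NNReal.continuous_coe.tendsto 0).mono_left nhdsWithin_le_nhds
      · filter_upwards [self_mem_nhdsWithin] with h hh
        exact (NNReal.coe_pos.2 hh).ne'
    have h3 := (hd.smul_const (R x)).sub (he.smul ((hR x).tendsto_average hT))
    rw [one_smul] at h3
    refine h3.congr' ?_
    filter_upwards [self_mem_nhdsWithin] with h hh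
    have h4 := (hR x).apply_eq hT hh
    have h5 : T h (R x) = Real.exp (l * h) • (R x - F x h) := by
      have h6 : R x - F x h = Real.exp (-l * h) • T h (R x) := by
        rw [sub_eq_iff_eq_add', ← h4]
      rw [h6, smul_smul, ← Real.exp_add]
      simp
    rw [h5]
    module
  have hright : ∀ x, ∃ z : A.domain, (z : X) = R x ∧ shifted A l z = x := by
    intro x
    obtain ⟨z, hz, hAz⟩ := hA.apply_eq (hderiv x)
    exact ⟨z, hz, by rw [shifted_apply, hAz, hz]; abel⟩
  have hRc : SeqContinuous R' := seqContinuous_of_seminorm fun p hp => by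
    obtain ⟨q, hq, hpq, hqT⟩ := hT.exists_seminorm hp
    refine ⟨q, hq, l⁻¹, fun x => ?_⟩
    have h1 := (hR x).seminorm_le hl hq hqT
    rw [div_eq_inv_mul] at h1
    exact (hpq _).trans h1
  have hleft : ∀ z : A.domain, R (shifted A l z) = z := by
    intro z
    -- `R` commutes with `T` and is sequentially continuous, hence carries the difference quotients
    -- of `z` to those of `R z`. Comparison with `hderiv` gives `R (A z) = l R z - z`.
    have h1 : Tendsto (fun h : ℝ≥0 => (h : ℝ)⁻¹ • (T h (R z) - R z)) (𝓝[>] 0) (𝓝 (R' (A z))) := by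
      refine (hRc.tendsto (hA.tendsto_apply z)).congr fun h => ?_
      rw [map_smul, map_sub]
      simp [R', hcomm]
    have h2 : R' (A z) = l • R z - z := tendsto_nhds_unique h1 (hderiv z)
    change R' (shifted A l z) = z
    rw [shifted_apply, map_sub, h2, map_smul]
    simp [R']
  have hb : Function.Bijective (shifted A l) := by
    refine ⟨fun a b hab => Subtype.ext ?_, fun x => ?_⟩
    · rw [← hleft a, hab, hleft b]
    · obtain ⟨z, -, hz⟩ := hright x
      exact ⟨z, hz⟩
  refine ⟨hb, fun x => ⟨F x, ?_⟩⟩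
  obtain ⟨z, hz, hzx⟩ := hright x
  have : resolventOp A l x = R x := by
    rw [← hz, ← resolventOp_shifted hb z, hzx]
  rw [this]
  exact hR x

theorem hilleYosidaCondition_of_laplace [LocallyConvexSpace ℝ X] (hT : IsC0SeqEquicontinuous T)
    (hL : HasLaplaceTransform T) (hA : IsInfinitesimalGenerator A T) :
    HilleYosidaCondition A := by
  have hres : ∀ l : ℝ, 0 < l → l ∈ resolventSet₀ A := by
    intro l hl
    obtain ⟨hb, hF⟩ := exists_laplace_resolvent hT hL hA hl
    refine mem_resolventSet₀_iff.2 ⟨hb, seqContinuous_of_seminorm fun p hp => ?_⟩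
    obtain ⟨q, hq, hpq, hqT⟩ := hT.exists_seminorm hp
    refine ⟨q, hq, l⁻¹, fun x => ?_⟩
    obtain ⟨F, h⟩ := hF x
    have h1 := h.seminorm_le hl hq hqT
    rw [div_eq_inv_mul] at h1
    exact (hpq _).trans h1
  refine ⟨isSeqClosedOp_of_mem_resolventSet₀ (hres 1 one_pos), fun x => ?_,
    fun n => n + 1, fun n => hres _ (by positivity),
    tendsto_atTop_add_const_right _ _ tendsto_natCast_atTop_atTop,
    seqEquicontinuous_of_seminorm fun p hp => ?_⟩
  · obtain ⟨hb, hF⟩ := exists_laplace_resolvent hT hL hA one_pos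
    obtain ⟨F, h⟩ := hF x
    obtain ⟨u, hu⟩ := exists_seq_tendsto (𝓝[>] (0 : ℝ≥0))
    have hpos := (tendsto_nhdsWithin_iff.1 hu).2
    obtain ⟨N, hN⟩ := eventually_atTop.1 hpos
    -- The averages of the orbit tend to `x` and lie in the domain, since `F s = R x - exp (-s) • T
    -- s (R x)`.
    refine ⟨fun n => (u (n + N) : ℝ)⁻¹ • F (u (n + N)), fun n => ?_,
      ((h.tendsto_average hT).comp hu).comp (tendsto_add_atTop_nat N)⟩
    have hy : resolventOp A 1 x ∈ A.domain := by
      obtain ⟨z, hz, -⟩ := exists_resolventOp_eq hb x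
      rw [hz]; exact z.2
    have hFy := h.apply_eq hT (hN (n + N) (Nat.le_add_left _ _))
    refine A.domain.smul_mem _ ?_
    rw [← sub_eq_iff_eq_add] at hFy
    rw [← hFy]
    exact A.domain.sub_mem hy (A.domain.smul_mem _ (hA.map_mem_domain hT _ hy))
  · obtain ⟨q, hq, hpq, hqT⟩ := hT.exists_seminorm hp
    refine ⟨q, hq, fun ⟨n, m⟩ x => (hpq _).trans ?_⟩
    have hpos : (0 : ℝ) < n + 1 := by positivity
    induction m with
    | zero => simp
    | succ m ih =>
      rw [pow_succ', Module.End.mul_apply]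
      refine le_trans ?_ ih
      set y := (((n : ℝ) + 1) • resolventOp A (n + 1) : Module.End ℝ X) ^ m
      obtain ⟨F, h⟩ := (exists_laplace_resolvent hT hL hA hpos).2 (y x)
      have h1 := h.seminorm_le hpos hq hqT
      rw [le_div_iff₀ hpos, mul_comm] at h1
      rw [LinearMap.smul_apply, map_smul_eq_mul, Real.norm_of_nonneg hpos.le]
      exact h1

end Generator

/-! ### Riemann sums tested by norming functionals. -/

/-- Hahn–Banach on the line through `y`. The functional lives in the algebraic dual, so `p` need not
be continuous. -/
theorem exists_norming_functional {X : Type*} [AddCommGroup X] [Module ℝ X] (p : Seminorm ℝ X)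
    (y : X) : ∃ φ : X →ₗ[ℝ] ℝ, φ y = p y ∧ ∀ x, |φ x| ≤ p x := by
  have H : ∀ c : ℝ, c • y = 0 → c • p y = 0 := fun c hc => by
    have h1 : |c| * p y = 0 := by
      rw [← Real.norm_eq_abs, ← map_smul_eq_mul, hc, map_zero]
    rcases mul_eq_zero.1 h1 with h | h
    · rw [abs_eq_zero.1 h, zero_smul]
    · rw [h, smul_zero]
  let L : X →ₗ.[ℝ] ℝ := LinearPMap.mkSpanSingleton' y (p y) H
  obtain ⟨g, hg, hgp⟩ := Module.Dual.exists_extension_of_le_seminorm_real (p := p)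
    L.domain L.toFun (by
      rintro ⟨x, hx⟩
      obtain ⟨c, rfl⟩ := Submodule.mem_span_singleton.1 hx
      refine (LinearPMap.mkSpanSingleton'_apply y (p y) H c hx).le.trans ?_
      rw [map_smul_eq_mul]
      exact mul_le_mul_of_nonneg_right (le_abs_self c) (apply_nonneg _ _))
  have hy : y ∈ L.domain := Submodule.mem_span_singleton_self y
  exact ⟨g, (hg ⟨y, hy⟩).trans (LinearPMap.mkSpanSingleton'_apply_self y (p y) H hy), hgp⟩

/-- `f` is uniformly continuous on `[0, ∞)` with respect to the seminorm `q`. -/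
def UniformModulus {X : Type*} [AddCommGroup X] [Module ℝ X] (q : Seminorm ℝ X) (f : ℝ → X) :
    Prop :=
  ∀ ε > 0, ∃ δ > 0, ∀ s ≥ 0, ∀ t ≥ 0, |s - t| < δ → q (f s - f t) ≤ ε

theorem abs_sum_sub_integral_le {g : ℝ → ℝ} (hg : ContinuousOn g (Set.Ici 0)) {δ ε : ℝ}
    (hε : ∀ s ≥ 0, ∀ t ≥ 0, |s - t| < δ → |g s - g t| ≤ ε) {a y : ℝ}
    (hy : y ∈ riemannSums g 0 a δ) : |y - ∫ t in (0 : ℝ)..a, g t| ≤ ε * a := by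
  -- Here `rfl'` is an ordinary name, for the hypothesis `t 0 = 0`.
  obtain ⟨n, t, s, rfl', rfl, H, rfl⟩ := hy
  have h0 : ∀ i ≤ n, 0 ≤ t i := by
    intro i
    induction i with
    | zero => exact fun _ => rfl'.ge
    | succ i ih =>
      intro hi
      have := H i hi
      linarith [ih (by omega)]
  have hint : ∀ i < n, IntervalIntegrable g MeasureTheory.volume (t i) (t (i + 1)) := by
    intro i hi
    refine (hg.mono fun x hx => ?_).intervalIntegrable
    rw [Set.uIcc_of_le ((H i hi).1.trans (H i hi).2.1)] at hx
    exact (h0 i hi.le).trans hx.1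
  rw [← rfl', ← intervalIntegral.sum_integral_adjacent_intervals hint, ← Finset.sum_sub_distrib]
  refine (Finset.abs_sum_le_sum_abs _ _).trans ?_
  have hterm : ∀ i ∈ Finset.range n, |(t (i + 1) - t i) • g (s i) - ∫ x in t i..t (i + 1), g x| ≤
      ε * (t (i + 1) - t i) := by
    intro i hi
    have hi := Finset.mem_range.1 hi
    obtain ⟨h1, h2, h3⟩ := H i hi
    have h4 : t i ≤ t (i + 1) := h1.trans h2
    rw [← intervalIntegral.integral_const, ← intervalIntegral.integral_sub
      intervalIntegrable_const (hint i hi), ← Real.norm_eq_abs, ← abs_of_nonneg (sub_nonneg.2 h4)]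
    refine intervalIntegral.norm_integral_le_of_norm_le_const fun x hx => ?_
    rw [Set.uIoc_of_le h4] at hx
    refine hε _ ((h0 i hi.le).trans h1) _ ((h0 i hi.le).trans hx.1.le) ?_
    rw [abs_lt]
    constructor <;> linarith [hx.1, hx.2]
  refine (Finset.sum_le_sum hterm).trans_eq ?_
  rw [← Finset.mul_sum, Finset.sum_range_sub, rfl', sub_zero]

section Dual

variable {X : Type*} [AddCommGroup X] [Module ℝ X] {q : Seminorm ℝ X} {f : ℝ → X}

theorem UniformModulus.continuousOn (hf : UniformModulus q f) {φ : X →ₗ[ℝ] ℝ}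
    (hφ : ∀ x, |φ x| ≤ q x) : ContinuousOn (fun t => φ (f t)) (Set.Ici 0) := by
  rw [Metric.continuousOn_iff]
  intro s hs ε hε
  obtain ⟨δ, hδ, H⟩ := hf (ε / 2) (half_pos hε)
  refine ⟨δ, hδ, fun t ht hts => ?_⟩
  rw [Real.dist_eq, ← map_sub]
  exact ((hφ _).trans (H t ht s hs hts)).trans_lt (half_lt_self hε)

theorem map_mem_riemannSums (φ : X →ₗ[ℝ] ℝ) {a b δ : ℝ} {y : X} (hy : y ∈ riemannSums f a b δ) :
    φ y ∈ riemannSums (fun t => φ (f t)) a b δ := by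
  obtain ⟨n, t, s, h0, hn, H, rfl⟩ := hy
  exact ⟨n, t, s, h0, hn, H, by simp⟩

theorem UniformModulus.abs_map_sub_integral_le (hf : UniformModulus q f) {φ : X →ₗ[ℝ] ℝ}
    (hφ : ∀ x, |φ x| ≤ q x) {δ ε : ℝ}
    (hε : ∀ s ≥ 0, ∀ t ≥ 0, |s - t| < δ → q (f s - f t) ≤ ε) {a : ℝ} {y : X}
    (hy : y ∈ riemannSums f 0 a δ) : |φ y - ∫ t in (0 : ℝ)..a, φ (f t)| ≤ ε * a := by
  refine abs_sum_sub_integral_le (hf.continuousOn hφ) (fun s hs t ht hst => ?_)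
    (map_mem_riemannSums φ hy)
  rw [← map_sub]
  exact (hφ _).trans (hε s hs t ht hst)

theorem UniformModulus.exists_riemannSums_close (hf : UniformModulus q f) {a : ℝ} (ha : 0 ≤ a)
    {ε : ℝ} (hε : 0 < ε) : ∃ δ > 0, ∀ y ∈ riemannSums f 0 a δ, ∀ z ∈ riemannSums f 0 a δ,
      q (y - z) < ε := by
  -- Both sums are close to the same scalar integral of `φ ∘ f`, with error at most this constant
  -- times `a`; `a + 1` keeps the denominator nonzero when `a = 0`.
  obtain ⟨δ, hδ, H⟩ := hf (ε / (2 * (a + 1))) (by positivity)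
  refine ⟨δ, hδ, fun y hy z hz => ?_⟩
  obtain ⟨φ, hφ, hφq⟩ := exists_norming_functional q (y - z)
  have h1 := abs_le.1 (hf.abs_map_sub_integral_le hφq H hy)
  have h2 := abs_le.1 (hf.abs_map_sub_integral_le hφq H hz)
  have h3 : ε / (2 * (a + 1)) * a + ε / (2 * (a + 1)) * a < ε := by
    have : ε / (2 * (a + 1)) * a + ε / (2 * (a + 1)) * a = ε * (a / (a + 1)) := by
      field_simp; ring
    rw [this]
    exact mul_lt_of_lt_one_right hε ((div_lt_one (by linarith)).2 (by linarith))
  rw [← hφ, map_sub]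
  linarith [h1.2, h2.1]

end Dual

/-! ### Existence of the Laplace transform under sequential completeness. -/

section Existence

variable {X : Type*} [AddCommGroup X] [Module ℝ X] [UniformSpace X] [IsUniformAddGroup X]
  [ContinuousSMul ℝ X] [LocallyConvexSpace ℝ X]

theorem exists_hasRiemannIntegral (hX : SeqComplete X) {f : ℝ → X}
    (hf : ∀ p : Seminorm ℝ X, Continuous p → UniformModulus p f) {a : ℝ} (ha : 0 ≤ a) :
    ∃ y, HasRiemannIntegral f 0 a y := by
  have hmem : ∀ δ > 0, ∃ N, ∀ n ≥ N, uniformSum f a 1 n ∈ riemannSums f 0 a δ := by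
    intro δ hδ
    obtain ⟨N, hN⟩ := eventually_atTop.1 ((tendsto_div_succ a).eventually_lt_const hδ)
    refine ⟨N, fun n hn => ?_⟩
    simpa using uniformSum_mem_riemannSums f ha 1 (hN n hn)
  obtain ⟨y, hy⟩ := hX (uniformSum f a 1) (cauchySeq_of_seminorm fun p hp ε hε => by
    obtain ⟨δ, hδ, H⟩ := (hf p hp).exists_riemannSums_close ha hε
    obtain ⟨N, hN⟩ := hmem δ hδ
    exact ⟨N, fun m hm n hn => H _ (hN m hm) _ (hN n hn)⟩)
  refine ⟨y, hasRiemannIntegral_iff.2 fun U hU => ?_⟩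
  obtain ⟨p, hp, ε, hε, hpU⟩ := exists_seminorm_of_mem_nhds hU
  obtain ⟨δ, hδ, H⟩ := (hf p hp).exists_riemannSums_close ha (half_pos hε)
  refine ⟨δ, hδ, fun z hz => hpU z ?_⟩
  obtain ⟨N, hN⟩ := hmem δ hδ
  obtain ⟨n, hn1, hn2⟩ := ((tendsto_iff_seminorm.1 hy p hp _ (half_pos hε)).and
    (eventually_ge_atTop N)).exists
  calc p (z - y) = p ((z - uniformSum f a 1 n) + (uniformSum f a 1 n - y)) := by
        rw [sub_add_sub_cancel]
    _ ≤ _ := map_add_le_add _ _ _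
    _ < ε := by linarith [H z hz _ (hN n hn2)]

/-- `φ` is controlled only by the sequentially continuous `q`, so the limit is taken along the
sequence of uniform sums. -/
theorem HasRiemannIntegral.map_eq_integral {q : Seminorm ℝ X} (hq : SeqContSeminorm q)
    {f : ℝ → X} (hf : UniformModulus q f) {φ : X →ₗ[ℝ] ℝ} (hφ : ∀ x, |φ x| ≤ q x) {a : ℝ}
    (ha : 0 ≤ a) {y : X} (hy : HasRiemannIntegral f 0 a y) :
    φ y = ∫ t in (0 : ℝ)..a, φ (f t) := by
  have hy' : HasRiemannIntegral f 0 ((1 : ℕ) * a) y := by rwa [Nat.cast_one, one_mul]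
  have hlim := hy'.tendsto_uniformSum ha
  have h1 : Tendsto (fun n => φ (uniformSum f a 1 n)) atTop (𝓝 (φ y)) := by
    rw [tendsto_iff_norm_sub_tendsto_zero]
    refine squeeze_zero (fun _ => norm_nonneg _) (fun n => ?_) (hq.tendsto_sub hlim)
    rw [← map_sub]
    exact hφ _
  refine tendsto_nhds_unique h1 ?_
  rw [Metric.tendsto_atTop]
  intro ε hε
  obtain ⟨δ, hδ, H⟩ := hf (ε / (a + 1)) (by positivity)
  obtain ⟨N, hN⟩ := eventually_atTop.1 ((tendsto_div_succ a).eventually_lt_const hδ)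
  refine ⟨N, fun n hn => ?_⟩
  have hmem := uniformSum_mem_riemannSums f ha 1 (hN n hn)
  rw [Nat.cast_one, one_mul] at hmem
  refine (hf.abs_map_sub_integral_le hφ H hmem).trans_lt ?_
  rw [div_mul_eq_mul_div, div_lt_iff₀ (by linarith)]
  nlinarith

variable {T : ℝ≥0 → X →ₗ[ℝ] X} {l : ℝ}

/-- An increment starting at `s` is `exp (-l * s) • T s` of the increment starting at `0`, and this
map contracts `q`. Right continuity at `0` thus becomes uniform continuity. -/
theorem uniformModulus_dampedOrbit (hT : IsC0SeqEquicontinuous T) (hl : 0 ≤ l) (x : X)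
    {q : Seminorm ℝ X} (hq : SeqContSeminorm q) (hqT : ∀ t x, q (T t x) ≤ q x) :
    UniformModulus q (dampedOrbit T l x) := by
  intro ε hε
  have h1 := (hq.tendsto_sub (tendsto_dampedOrbit hT l x)).eventually_lt_const hε
  obtain ⟨δ, hδ, hsub⟩ := mem_nhdsGT_iff_exists_Ioo_subset.1 h1
  have key : ∀ s ≥ 0, ∀ r ≥ 0, r < (δ : ℝ) →
      q (dampedOrbit T l x (s + r) - dampedOrbit T l x s) ≤ ε := by
    intro s hs r hr hrδ
    lift s to ℝ≥0 using hs
    lift r to ℝ≥0 using hr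
    have h2 : dampedOrbit T l x (s + r) - dampedOrbit T l x s =
        Real.exp (-l * s) • T s (dampedOrbit T l x r - x) := by
      rw [dampedOrbit_add hT x s r.coe_nonneg, map_sub, smul_sub]
      simp [dampedOrbit]
    rw [h2, map_smul_eq_mul, Real.norm_of_nonneg (Real.exp_pos _).le]
    have h3 : Real.exp (-l * s) ≤ 1 := by
      rw [Real.exp_le_one_iff]
      nlinarith [mul_nonneg hl s.coe_nonneg]
    refine (mul_le_of_le_one_left (apply_nonneg _ _) h3).trans ((hqT _ _).trans ?_)
    rcases eq_or_lt_of_le (zero_le (a := r)) with rfl | hr0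
    · simp [dampedOrbit, hT.zero, hε.le]
    · exact (hsub ⟨hr0, hrδ⟩ : _ < ε).le
  refine ⟨δ, hδ, fun s hs t ht hst => ?_⟩
  rcases le_total s t with h | h
  · have := key s hs (t - s) (sub_nonneg.2 h) (by rw [abs_lt] at hst; linarith)
    rwa [add_sub_cancel, map_sub_rev] at this
  · have := key t ht (s - t) (sub_nonneg.2 h) (by rw [abs_lt] at hst; linarith)
    rwa [add_sub_cancel] at this

theorem integral_exp_neg_mul_le {l a b : ℝ} (hl : 0 < l) :
    ∫ t in a..b, Real.exp (-l * t) ≤ Real.exp (-l * a) / l := by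
  have h : ∀ t ∈ Set.uIcc a b,
      HasDerivAt (fun t => -(Real.exp (-l * t) / l)) (Real.exp (-l * t)) t := by
    intro t _
    have h1 := (((hasDerivAt_id t).const_mul (-l)).exp.div_const l).neg
    convert! h1 using 1
    field_simp
    simp
  rw [intervalIntegral.integral_eq_sub_of_hasDerivAt h
    (Continuous.intervalIntegrable (by fun_prop) _ _)]
  have : 0 ≤ Real.exp (-l * b) / l := by positivity
  linarith

/-- In a sequentially complete space every `C₀`-sequentially equicontinuous semigroup has a
Laplace transform. -/
theorem IsC0SeqEquicontinuous.hasLaplaceTransform (hX : SeqComplete X)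
    (hT : IsC0SeqEquicontinuous T) : HasLaplaceTransform T := by
  intro x l hl
  have hex : ∀ a : ℝ, ∃ y, 0 ≤ a → HasRiemannIntegral (dampedOrbit T l x) 0 a y := by
    intro a
    by_cases ha : 0 ≤ a
    · obtain ⟨y, hy⟩ := exists_hasRiemannIntegral hX (f := dampedOrbit T l x) (fun p hp ε hε => by
        obtain ⟨q, hq, hpq, hqT⟩ := hT.exists_seminorm hp
        obtain ⟨δ, hδ, H⟩ := uniformModulus_dampedOrbit hT hl.le x hq hqT ε hε
        exact ⟨δ, hδ, fun s hs t ht hst => (hpq _).trans (H s hs t ht hst)⟩) ha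
      exact ⟨y, fun _ => hy⟩
    · exact ⟨0, fun h => absurd h ha⟩
  choose F hF using hex
  -- The functional norming `F b - F a` turns it into a scalar integral over `[a, b]`, dominated by
  -- `exp (-l * t) * q x`.
  have hbound : ∀ q : Seminorm ℝ X, SeqContSeminorm q → (∀ t x, q (T t x) ≤ q x) →
      ∀ a ≥ 0, ∀ b ≥ a, q (F b - F a) ≤ Real.exp (-l * a) / l * q x := by
    intro q hq hqT a ha b hab
    obtain ⟨φ, hφ, hφq⟩ := exists_norming_functional q (F b - F a)
    have hm := uniformModulus_dampedOrbit hT hl.le x hq hqT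
    have hint : ∀ c d, 0 ≤ c → 0 ≤ d → IntervalIntegrable (fun t => φ (dampedOrbit T l x t))
        MeasureTheory.volume c d := fun c d hc hd =>
      ((hm.continuousOn hφq).mono fun t ht => (le_min hc hd).trans ht.1).intervalIntegrable
    have hb : 0 ≤ b := ha.trans hab
    rw [← hφ, map_sub, (hF b hb).map_eq_integral hq hm hφq hb,
      (hF a ha).map_eq_integral hq hm hφq ha,
      intervalIntegral.integral_interval_sub_left (hint 0 b le_rfl hb) (hint 0 a le_rfl ha)]
    calc ∫ t in a..b, φ (dampedOrbit T l x t) ≤ ∫ t in a..b, Real.exp (-l * t) * q x := by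
          refine intervalIntegral.integral_mono_on hab (hint a b ha hb)
            (Continuous.intervalIntegrable (by fun_prop) _ _) fun t _ => ?_
          refine (le_abs_self _).trans ((hφq _).trans ?_)
          rw [dampedOrbit, map_smul_eq_mul, Real.norm_of_nonneg (Real.exp_pos _).le]
          exact mul_le_mul_of_nonneg_left (hqT _ _) (Real.exp_pos _).le
      _ ≤ _ := by
          rw [intervalIntegral.integral_mul_const]
          exact mul_le_mul_of_nonneg_right (integral_exp_neg_mul_le hl) (apply_nonneg _ _)
  have hsmall : ∀ p : Seminorm ℝ X, Continuous p → ∀ ε > 0, ∃ N : ℕ, ∀ a ≥ (N : ℝ), ∀ b ≥ a,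
      p (F b - F a) < ε := by
    intro p hp ε hε
    obtain ⟨q, hq, hpq, hqT⟩ := hT.exists_seminorm hp
    have hlim : Tendsto (fun a : ℝ => Real.exp (-l * a) / l * q x) atTop (𝓝 0) := by
      have h1 : Tendsto (fun a : ℝ => -l * a) atTop atBot :=
        tendsto_id.const_mul_atTop_of_neg (neg_lt_zero.2 hl)
      simpa using ((Real.tendsto_exp_atBot.comp h1).div_const l).mul_const (q x)
    obtain ⟨N, hN⟩ := eventually_atTop.1 (hlim.eventually_lt_const hε)
    obtain ⟨M, hM⟩ := exists_nat_ge N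
    refine ⟨M, fun a ha b hab => (hpq _).trans_lt ?_⟩
    exact (hbound q hq hqT a (M.cast_nonneg.trans ha) b hab).trans_lt (hN a (hM.trans ha))
  obtain ⟨y, hy⟩ := hX (fun n : ℕ => F n) (cauchySeq_of_seminorm fun p hp ε hε => by
    obtain ⟨N, hN⟩ := hsmall p hp ε hε
    refine ⟨N, fun m hm n hn => ?_⟩
    rcases le_total m n with h | h
    · rw [map_sub_rev]
      exact hN m (by exact_mod_cast hm) n (by exact_mod_cast h)
    · exact hN n (by exact_mod_cast hn) m (by exact_mod_cast h))
  refine ⟨F, fun a ha => hF a ha, y, tendsto_iff_seminorm.2 fun p hp ε hε => ?_⟩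
  obtain ⟨N, hN⟩ := hsmall p hp (ε / 2) (half_pos hε)
  obtain ⟨n, hn1, hn2⟩ := ((tendsto_iff_seminorm.1 hy p hp _ (half_pos hε)).and
    (eventually_ge_atTop N)).exists
  filter_upwards [eventually_ge_atTop (n : ℝ)] with a ha
  calc p (F a - y) = p ((F a - F n) + (F n - y)) := by rw [sub_add_sub_cancel]
    _ ≤ _ := map_add_le_add _ _ _
    _ < ε := by linarith [hN n (by exact_mod_cast hn2) a ha]

end Existence

/-! ### Estimates for the implicit Euler method. -/

section Euler

variable {X : Type*} [AddCommGroup X] [Module ℝ X]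

/-- `A` is dissipative with respect to the seminorm `q`. -/
def Dissipative (A : X →ₗ.[ℝ] X) (q : Seminorm ℝ X) : Prop :=
  ∀ σ > (0 : ℝ), ∀ z : A.domain, q z ≤ q (z - σ • A z)

/-- `J = (1 - σA)⁻¹`: one step of length `σ` of the implicit Euler method for `u' = Au`. -/
structure IsEulerStep (A : X →ₗ.[ℝ] X) (σ : ℝ) (J : Module.End ℝ X) : Prop where
  exists_eq : ∀ x, ∃ z : A.domain, (z : X) = J x ∧ (z : X) - σ • A z = x
  apply_sub : ∀ z : A.domain, J (z - σ • A z) = z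

theorem isEulerStep_resolventOp {A : X →ₗ.[ℝ] X} {l : ℝ} (hl : 0 < l)
    (h : Function.Bijective (shifted A l)) :
    IsEulerStep A l⁻¹ (l • resolventOp A l : Module.End ℝ X) where
  exists_eq x := by
    obtain ⟨y, hy, hyx⟩ := exists_resolventOp_eq h x
    refine ⟨l • y, ?_, ?_⟩
    · rw [LinearMap.smul_apply, hy]; rfl
    · rw [A.map_smul, smul_smul, inv_mul_cancel₀ hl.ne', one_smul]
      exact hyx
  apply_sub z := by
    have h1 : (z : X) - l⁻¹ • A z = l⁻¹ • shifted A l z := by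
      rw [shifted_apply, smul_sub, smul_smul, inv_mul_cancel₀ hl.ne', one_smul]
    rw [h1, LinearMap.smul_apply, map_smul, smul_smul, mul_inv_cancel₀ hl.ne', one_smul,
      resolventOp_shifted h]

variable {A : X →ₗ.[ℝ] X} {q : Seminorm ℝ X} {σ τ : ℝ} {J K : Module.End ℝ X}

theorem seminorm_pow_le (h : ∀ x, q (J x) ≤ q x) (m : ℕ) (x : X) : q ((J ^ m) x) ≤ q x := by
  induction m with
  | zero => simp
  | succ m ih =>
    rw [pow_succ', Module.End.mul_apply]
    exact (h _).trans ih

theorem IsEulerStep.seminorm_le (hJ : IsEulerStep A σ J) (hσ : 0 < σ) (hq : Dissipative A q)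
    (x : X) : q (J x) ≤ q x := by
  obtain ⟨z, hz, hzx⟩ := hJ.exists_eq x
  rw [← hz]
  exact (hq σ hσ z).trans_eq (by rw [hzx])

theorem IsEulerStep.pow_seminorm_le (hJ : IsEulerStep A σ J) (hσ : 0 < σ) (hq : Dissipative A q)
    (m : ℕ) (x : X) : q ((J ^ m) x) ≤ q x :=
  seminorm_pow_le (hJ.seminorm_le hσ hq) m x

theorem IsEulerStep.apply_sub_self (hJ : IsEulerStep A σ J) (z : A.domain) :
    J z - z = σ • J (A z) := by
  have h := hJ.apply_sub z
  rw [map_sub, map_smul] at h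
  rw [sub_eq_iff_eq_add, ← sub_eq_iff_eq_add', h]

theorem IsEulerStep.pow_succ_sub (hJ : IsEulerStep A σ J) (z : A.domain) (m : ℕ) :
    (J ^ (m + 1)) z - (J ^ m) z = σ • (J ^ (m + 1)) (A z) := by
  rw [pow_succ, Module.End.mul_apply, Module.End.mul_apply, ← map_sub, hJ.apply_sub_self, map_smul]

theorem IsEulerStep.pow_sub_self_le (hJ : IsEulerStep A σ J) (hσ : 0 < σ)
    (hq : Dissipative A q) (z : A.domain) (m : ℕ) : q ((J ^ m) z - z) ≤ m * σ * q (A z) := by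
  induction m with
  | zero => simp
  | succ m ih =>
    have h1 : (J ^ (m + 1)) (z : X) - z = σ • (J ^ (m + 1)) (A z) + ((J ^ m) z - z) := by
      rw [← hJ.pow_succ_sub, sub_add_sub_cancel]
    rw [h1]
    refine (map_add_le_add _ _ _).trans ?_
    rw [map_smul_eq_mul, Real.norm_of_nonneg hσ.le]
    have h2 := mul_le_mul_of_nonneg_left (hJ.pow_seminorm_le hσ hq (m + 1) (A z)) hσ.le
    push_cast
    linarith

theorem convex_sqrt_le {a b u v : ℝ} (ha : 0 ≤ a) (hb : 0 ≤ b) (hab : a + b = 1) (hu : 0 ≤ u)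
    (hv : 0 ≤ v) : a * √u + b * √v ≤ √(a * u + b * v) := by
  have := Real.strictConcaveOn_sqrt.concaveOn.2 hu hv ha hb hab
  simpa using this

/-- The distance of two implicit Euler approximations with step sizes `σ` and `τ`. -/
theorem IsEulerStep.pow_sub_pow_le (hJ : IsEulerStep A σ J) (hσ : 0 < σ) (hK : IsEulerStep A τ K)
    (hτ : 0 < τ) (hq : Dissipative A q) (z : A.domain) (m n : ℕ) :
    q ((J ^ m) z - (K ^ n) z) ≤
      q (A z) * √((m * σ - n * τ) ^ 2 + m * σ ^ 2 + n * τ ^ 2) := by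
  have hC : 0 ≤ q (A z) := apply_nonneg _ _
  induction m generalizing n with
  | zero =>
    rw [map_sub_rev, pow_zero, Module.End.one_apply]
    refine (hK.pow_sub_self_le hτ hq z n).trans ?_
    rw [mul_comm]
    refine mul_le_mul_of_nonneg_left (Real.le_sqrt_of_sq_le ?_) hC
    have : 0 ≤ (n : ℝ) * τ ^ 2 := by positivity
    push_cast
    nlinarith
  | succ m ihm =>
    induction n with
    | zero =>
      rw [pow_zero, Module.End.one_apply]
      refine (hJ.pow_sub_self_le hσ hq z _).trans ?_
      rw [mul_comm]
      refine mul_le_mul_of_nonneg_left (Real.le_sqrt_of_sq_le ?_) hC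
      have : 0 ≤ ((m + 1 : ℕ) : ℝ) * σ ^ 2 := by positivity
      rw [Nat.cast_zero]
      nlinarith
    | succ n ihn =>
      have hs : 0 < σ + τ := by positivity
      -- These weights satisfy `a * τ = b * σ`, so a single dissipativity inequality with parameter
      -- `a * τ` absorbs one step of each method.
      set a := σ / (σ + τ) with ha
      set b := τ / (σ + τ) with hb
      have ha1 : 0 < a := by positivity
      have ha0 : 0 ≤ a := ha1.le
      have hb0 : 0 ≤ b := by positivity
      have hab : a + b = 1 := by rw [ha, hb]; field_simp
      have haτ : a * τ = b * σ := by rw [ha, hb]; ring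
      obtain ⟨u, hu, hu'⟩ := hJ.exists_eq ((J ^ m) z)
      obtain ⟨v, hv, hv'⟩ := hK.exists_eq ((K ^ n) z)
      rw [← Module.End.mul_apply, ← pow_succ'] at hu hv
      have hstep : q ((J ^ (m + 1)) z - (K ^ (n + 1)) z) ≤
          a * q ((J ^ (m + 1)) z - (K ^ n) z) + b * q ((J ^ m) z - (K ^ (n + 1)) z) := by
        have h1 := hq (a * τ) (mul_pos ha1 hτ) (u - v)
        rw [A.map_sub, Submodule.coe_sub] at h1
        have h2 : (u : X) - v - (a * τ) • (A u - A v) =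
            a • ((u : X) - (v - τ • A v)) + b • ((u - σ • A u) - (v : X)) := by
          have e1 : (u : X) - v = (a + b) • ((u : X) - v) := by rw [hab, one_smul]
          have e2 : (a * τ) • A u = (b * σ) • A u := by rw [haτ]
          rw [e1, smul_sub (a * τ), e2]
          module
        rw [h2, hu', hv', hu, hv] at h1
        refine h1.trans ((map_add_le_add _ _ _).trans_eq ?_)
        rw [map_smul_eq_mul, map_smul_eq_mul, Real.norm_of_nonneg ha0, Real.norm_of_nonneg hb0]
      refine hstep.trans ((add_le_add (mul_le_mul_of_nonneg_left ihn ha0)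
        (mul_le_mul_of_nonneg_left (ihm (n + 1)) hb0)).trans ?_)
      have h3 := convex_sqrt_le ha0 hb0 hab
        (u := (((m + 1 : ℕ) : ℝ) * σ - n * τ) ^ 2 + ((m + 1 : ℕ) : ℝ) * σ ^ 2 + n * τ ^ 2)
        (v := ((m : ℝ) * σ - ((n + 1 : ℕ) : ℝ) * τ) ^ 2 + m * σ ^ 2 + ((n + 1 : ℕ) : ℝ) * τ ^ 2)
        (by positivity) (by positivity)
      have h4 := mul_le_mul_of_nonneg_left h3 hC
      refine le_trans (le_of_eq (by ring)) (h4.trans_eq ?_)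
      congr 2
      have hb1 : b = 1 - a := by linarith
      rw [hb1] at haτ ⊢
      push_cast
      -- The cross terms of the two squares cancel because `a * τ = b * σ`.
      linear_combination (2 * ((m + 1 : ℝ) * σ - (n + 1) * τ)) * haτ

/-- The left side is the telescoping sum of `σ • ((J ^ i) (A z) - A z)` over `1 ≤ i ≤ m`. As `A z`
may lie outside the domain, the slack `c` leaves room for approximating it by domain elements. -/
theorem IsEulerStep.pow_sub_self_sub_le (hJ : IsEulerStep A σ J) (hσ : 0 < σ) (z : A.domain)
    {c C : ℝ} (hC : 0 ≤ C) (h : ∀ i : ℕ, q ((J ^ i) (A z) - A z) ≤ c + i * σ * C) (m : ℕ) :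
    q ((J ^ m) z - z - ((m : ℝ) * σ) • A z) ≤ m * σ * (c + m * σ * C) := by
  induction m with
  | zero => simp
  | succ m ih =>
    have h1 : (J ^ (m + 1)) (z : X) - z - (((m + 1 : ℕ) : ℝ) * σ) • A z =
        ((J ^ m) z - z - ((m : ℝ) * σ) • A z) + σ • ((J ^ (m + 1)) (A z) - A z) := by
      rw [smul_sub, ← hJ.pow_succ_sub]
      push_cast
      module
    rw [h1]
    refine (map_add_le_add _ _ _).trans ?_
    rw [map_smul_eq_mul, Real.norm_of_nonneg hσ.le]
    have h2 := mul_le_mul_of_nonneg_left (h (m + 1)) hσ.le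
    have h3 : 0 ≤ (m : ℝ) * σ * (σ * C) := by positivity
    push_cast at h2 ⊢
    nlinarith

end Euler

/-! ### Renorming, and the semigroup as a limit of Euler steps. -/

section Scheme

variable {X : Type*} [AddCommGroup X] [Module ℝ X] [TopologicalSpace X]

/-- Implicit Euler steps for `A` whose lengths tend to `0`, together with enough seminorms for
which `A` is dissipative. -/
structure IsEulerScheme (A : X →ₗ.[ℝ] X) (σ : ℕ → ℝ) (J : ℕ → Module.End ℝ X) : Prop where
  pos : ∀ n, 0 < σ n
  tendsto_zero : Tendsto σ atTop (𝓝 0)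
  step : ∀ n, IsEulerStep A (σ n) (J n)
  exists_seminorm : ∀ p : Seminorm ℝ X, Continuous p →
    ∃ q : Seminorm ℝ X, SeqContSeminorm q ∧ (∀ x, p x ≤ q x) ∧ Dissipative A q
  dense : SeqDense (A.domain : Set X)

theorem SeqEquicontinuous.comp {ι κ Y : Type*} [TopologicalSpace Y] [AddCommGroup Y]
    {f : ι → X → Y} (hf : SeqEquicontinuous f) (g : κ → ι) :
    SeqEquicontinuous fun k => f (g k) := fun x u hu U hU => by
  obtain ⟨N, hN⟩ := hf x u hu U hU
  exact ⟨N, fun k => hN (g k)⟩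

/-- Let `r n` be the supremum of `p` along the powers of `J n`. Then `J n` contracts `r n`, which
gives dissipativity of `A` for parameters `s ≥ σ n`. The `r n` grow as `σ n` shrinks, so their
supremum `q` inherits dissipativity for every `s > 0`. -/
theorem exists_dissipative_seminorm [ContinuousSMul ℝ X] {A : X →ₗ.[ℝ] X} {σ : ℕ → ℝ}
    {J : ℕ → Module.End ℝ X} (hσ : ∀ n, 0 < σ n) (hσ0 : Tendsto σ atTop (𝓝 0))
    (hJ : ∀ n, IsEulerStep A (σ n) (J n))
    (heq : SeqEquicontinuous fun (i : ℕ × ℕ) (x : X) => (J i.1 ^ i.2) x) {p : Seminorm ℝ X}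
    (hp : Continuous p) :
    ∃ q : Seminorm ℝ X, SeqContSeminorm q ∧ (∀ x, p x ≤ q x) ∧ Dissipative A q := by
  obtain ⟨q, hq, hpq, hmin⟩ :=
    SeqEquicontinuous.exists_seminorm (f := fun i : ℕ × ℕ => J i.1 ^ i.2) heq hp
  choose r _ hpr hrmin using fun n => SeqEquicontinuous.exists_seminorm
    (f := fun m : ℕ => J n ^ m) (heq.comp fun m => (n, m)) hp
  have hrJ : ∀ n x, r n (J n x) ≤ r n x := fun n x => hrmin _ _ _ fun m => by
    rw [← Module.End.mul_apply, ← pow_succ]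
    exact hpr _ _ _
  have hdiss : ∀ n s, σ n ≤ s → ∀ z : A.domain, r n z ≤ r n (z - s • A z) := by
    intro n s hs z
    have hs0 : 0 < s := (hσ n).trans_le hs
    have hc : 0 < σ n / s := div_pos (hσ n) hs0
    have hc1 : 0 ≤ 1 - σ n / s := sub_nonneg.2 ((div_le_one hs0).2 hs)
    -- A convex combination: the `r n z` term on the right is absorbed on the left.
    have h1 : (z : X) - σ n • A z = (σ n / s) • ((z : X) - s • A z) + (1 - σ n / s) • (z : X) := by
      have : σ n = σ n / s * s := by field_simp
      nth_rewrite 1 [this]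
      module
    have h2 : r n z ≤ r n (z - σ n • A z) := by
      have := hrJ n (z - σ n • A z)
      rwa [(hJ n).apply_sub] at this
    have h3 := h2.trans ((congrArg (r n) h1).trans_le (map_add_le_add _ _ _))
    rw [map_smul_eq_mul, map_smul_eq_mul, Real.norm_of_nonneg hc.le,
      Real.norm_of_nonneg hc1] at h3
    exact le_of_mul_le_mul_left (by linarith) hc
  have hmono : ∀ k n, σ n ≤ σ k → ∀ x, r k x ≤ r n x := by
    intro k n hkn x
    refine hrmin _ _ _ fun m => ?_
    have h0 : ∀ y, p y ≤ r n y := fun y => by simpa using hpr n 0 y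
    -- `J k` also contracts `r n`, as its step `σ k ≥ σ n` is one for which `A` is already
    -- dissipative.
    refine (h0 _).trans (seminorm_pow_le (fun y => ?_) m x)
    obtain ⟨z, hz, hzy⟩ := (hJ k).exists_eq y
    rw [← hz]
    exact (hdiss n _ hkn z).trans_eq (by rw [hzy])
  refine ⟨q, hq, fun x => by simpa using hpq (0, 0) x, fun s hs z => hmin _ _ ?_⟩
  rintro ⟨k, m⟩
  obtain ⟨n, hn⟩ := (hσ0.eventually_lt_const (lt_min (hσ k) hs)).exists
  calc p ((J k ^ m) z) ≤ r k z := hpr k m z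
    _ ≤ r n z := hmono k n (hn.le.trans (min_le_left _ _)) z
    _ ≤ r n (z - s • A z) := hdiss n s (hn.le.trans (min_le_right _ _)) z
    _ ≤ q (z - s • A z) := hrmin _ _ _ fun m => hpq (n, m) _

theorem HilleYosidaCondition.exists_isEulerScheme [ContinuousSMul ℝ X] {A : X →ₗ.[ℝ] X}
    (hA : HilleYosidaCondition A) : ∃ σ J, IsEulerScheme A σ J := by
  obtain ⟨l, hl, hlim, heq⟩ := hA.exists_seq
  obtain ⟨N, hN⟩ := eventually_atTop.1 (hlim.eventually_gt_atTop 0)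
  have hpos : ∀ n, 0 < l (n + N) := fun n => hN _ (Nat.le_add_left _ _)
  have hlim0 : Tendsto (fun n => (l (n + N))⁻¹) atTop (𝓝 0) :=
    tendsto_inv_atTop_zero.comp (hlim.comp (tendsto_add_atTop_nat N))
  have hstep := fun n => isEulerStep_resolventOp (hpos n) (mem_resolventSet₀_iff.1 (hl (n + N))).1
  exact ⟨fun n => (l (n + N))⁻¹, fun n => l (n + N) • resolventOp A (l (n + N)),
    fun n => inv_pos.2 (hpos n), hlim0, hstep,
    fun p hp => exists_dissipative_seminorm (fun n => inv_pos.2 (hpos n)) hlim0 hstep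
      (heq.comp fun i : ℕ × ℕ => (i.1 + N, i.2)) hp, hA.seqDense⟩

variable [IsTopologicalAddGroup X] {A : X →ₗ.[ℝ] X} {σ : ℕ → ℝ} {J : ℕ → Module.End ℝ X}
  {q : Seminorm ℝ X}

theorem SeqDense.exists_seminorm_sub_lt {S : Submodule ℝ X} (hS : SeqDense (S : Set X))
    (hq : SeqContSeminorm q) (x : X) {ε : ℝ} (hε : 0 < ε) : ∃ z : S, q (x - z) < ε := by
  obtain ⟨u, hu, hux⟩ := hS x
  obtain ⟨n, hn⟩ := ((hq.tendsto_sub hux).eventually_lt_const hε).exists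
  exact ⟨⟨u n, hu n⟩, by rwa [map_sub_rev]⟩

namespace IsEulerScheme

theorem pow_seminorm_le (h : IsEulerScheme A σ J) (hqA : Dissipative A q) (n m : ℕ) (x : X) :
    q ((J n ^ m) x) ≤ q x :=
  (h.step n).pow_seminorm_le (h.pos n) hqA m x

theorem exists_steps (h : IsEulerScheme A σ J) (t : ℝ≥0) :
    ∃ k : ℕ → ℕ, Tendsto (fun n => (k n : ℝ) * σ n) atTop (𝓝 t) := by
  refine ⟨fun n => ⌊(t : ℝ) * (σ n)⁻¹⌋₊, ?_⟩
  have h1 : Tendsto (fun n => (σ n)⁻¹) atTop atTop :=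
    tendsto_inv_nhdsGT_zero.comp (tendsto_nhdsWithin_iff.2
      ⟨h.tendsto_zero, Eventually.of_forall h.pos⟩)
  refine ((tendsto_nat_floor_mul_div_atTop t.coe_nonneg).comp h1).congr fun n => ?_
  simp

/-- Two step counts `k` and `j` are allowed: `k = j` gives the Cauchy property, `k ≠ j` the
independence of the limit from the choice of steps. -/
theorem eventually_pow_sub_pow_lt (h : IsEulerScheme A σ J) (hq : SeqContSeminorm q)
    (hqA : Dissipative A q) {t : ℝ} {k j : ℕ → ℕ}
    (hk : Tendsto (fun n => (k n : ℝ) * σ n) atTop (𝓝 t))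
    (hj : Tendsto (fun n => (j n : ℝ) * σ n) atTop (𝓝 t)) (x : X) {ε : ℝ} (hε : 0 < ε) :
    ∃ N, ∀ m ≥ N, ∀ n ≥ N, q ((J m ^ k m) x - (J n ^ j n) x) < ε := by
  obtain ⟨z, hz⟩ := h.dense.exists_seminorm_sub_lt hq x (show 0 < ε / 4 by positivity)
  have hσ := h.tendsto_zero
  have hlim : Tendsto (fun i : ℕ × ℕ => q (A z) * √((k i.1 * σ i.1 - j i.2 * σ i.2) ^ 2 +
      k i.1 * σ i.1 ^ 2 + j i.2 * σ i.2 ^ 2)) (atTop ×ˢ atTop) (𝓝 0) := by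
    have f1 := hk.comp (tendsto_fst (f := atTop) (g := (atTop : Filter ℕ)))
    have f2 := hj.comp (tendsto_snd (f := (atTop : Filter ℕ)) (g := atTop))
    have s1 := hσ.comp (tendsto_fst (f := atTop) (g := (atTop : Filter ℕ)))
    have s2 := hσ.comp (tendsto_snd (f := (atTop : Filter ℕ)) (g := atTop))
    have h1 := (((f1.sub f2).pow 2).add (f1.mul s1)).add (f2.mul s2)
    have h2 := (h1.sqrt).const_mul (q (A z))
    simp only [sub_self, mul_zero, add_zero, ne_eq, OfNat.ofNat_ne_zero, not_false_eq_true,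
      zero_pow, Real.sqrt_zero] at h2
    refine h2.congr fun i => ?_
    simp only [Function.comp_apply]
    ring_nf
  have hev := hlim.eventually_lt_const (half_pos hε)
  rw [prod_atTop_atTop_eq, eventually_atTop] at hev
  obtain ⟨⟨N, M⟩, hNM⟩ := hev
  refine ⟨max N M, fun m hm n hn => ?_⟩
  have h1 := hNM (m, n) ⟨(le_max_left _ _).trans hm, (le_max_right _ _).trans hn⟩
  have h2 := (h.step m).pow_sub_pow_le (h.pos m) (h.step n) (h.pos n) hqA z (k m) (j n)
  have h3 : (J m ^ k m) x - (J n ^ j n) x = (J m ^ k m) (x - z) +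
      (((J m ^ k m) z - (J n ^ j n) z) - (J n ^ j n) (x - z)) := by
    rw [map_sub, map_sub]; abel
  rw [h3]
  have h4 := map_add_le_add q ((J m ^ k m) (x - z))
    (((J m ^ k m) z - (J n ^ j n) z) - (J n ^ j n) (x - z))
  have h5 := map_sub_le_add q ((J m ^ k m) (z : X) - (J n ^ j n) z) ((J n ^ j n) (x - z))
  have h6 := h.pow_seminorm_le hqA m (k m) (x - z)
  have h7 := h.pow_seminorm_le hqA n (j n) (x - z)
  linarith

end IsEulerScheme

variable [T2Space X] {T : ℝ≥0 → X →ₗ[ℝ] X}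

/-- `T t` is the limit of the implicit Euler approximations at time `t`. -/
def IsEulerLimit (σ : ℕ → ℝ) (J : ℕ → Module.End ℝ X) (T : ℝ≥0 → X →ₗ[ℝ] X) : Prop :=
  ∀ (t : ℝ≥0) (k : ℕ → ℕ), Tendsto (fun n => (k n : ℝ) * σ n) atTop (𝓝 t) →
    ∀ x, Tendsto (fun n => (J n ^ k n) x) atTop (𝓝 (T t x))

namespace IsEulerLimit

theorem seminorm_le (hT : IsEulerLimit σ J T) (h : IsEulerScheme A σ J) (hq : SeqContSeminorm q)
    (hqA : Dissipative A q) (t : ℝ≥0) (x : X) : q (T t x) ≤ q x := by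
  obtain ⟨k, hk⟩ := h.exists_steps t
  exact hq.le_of_tendsto (hT t k hk x) (Eventually.of_forall fun n => h.pow_seminorm_le hqA _ _ _)

theorem apply_sub_self_le (hT : IsEulerLimit σ J T) (h : IsEulerScheme A σ J)
    (hq : SeqContSeminorm q) (hqA : Dissipative A q) (t : ℝ≥0) (z : A.domain) :
    q (T t z - z) ≤ t * q (A z) := by
  obtain ⟨k, hk⟩ := h.exists_steps t
  exact le_of_tendsto_of_tendsto' (hq.tendsto ((hT t k hk z).sub_const _)) (hk.mul_const _)
    fun n => (h.step n).pow_sub_self_le (h.pos n) hqA z (k n)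

theorem apply_sub_self_sub_le [ContinuousSMul ℝ X] (hT : IsEulerLimit σ J T)
    (h : IsEulerScheme A σ J) (hq : SeqContSeminorm q) (hqA : Dissipative A q) (z w : A.domain)
    (t : ℝ≥0) :
    q (T t z - z - (t : ℝ) • A z) ≤ t * (2 * q (A z - w) + t * q (A w)) := by
  obtain ⟨k, hk⟩ := h.exists_steps t
  refine le_of_tendsto_of_tendsto'
    (hq.tendsto (((hT t k hk z).sub_const _).sub (hk.smul_const (A z))))
    (hk.mul ((hk.mul_const (q (A w))).const_add _)) fun n =>
      (h.step n).pow_sub_self_sub_le (h.pos n) z (apply_nonneg _ _) (fun i => ?_) (k n)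
  -- Replacing `A z` by `w` in the domain costs `q (A z - w)` twice; the rest drifts by at most `i *
  -- σ n * q (A w)`.
  have h1 : (J n ^ i) (A z) - A z = (J n ^ i) (A z - w) + (((J n ^ i) w - w) - (A z - w)) := by
    rw [map_sub]; abel
  rw [h1]
  have h2 := map_add_le_add q ((J n ^ i) (A z - w)) (((J n ^ i) w - w) - (A z - w))
  have h3 := map_sub_le_add q ((J n ^ i) (w : X) - w) (A z - w)
  have h4 := h.pow_seminorm_le hqA n i (A z - w)
  have h5 := (h.step n).pow_sub_self_le (h.pos n) hqA w i
  linarith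

variable [ContinuousSMul ℝ X] [LocallyConvexSpace ℝ X]

theorem isC0SeqEquicontinuous (hT : IsEulerLimit σ J T) (h : IsEulerScheme A σ J) :
    IsC0SeqEquicontinuous T where
  zero := by
    ext x
    have h1 := hT 0 (fun _ => 0) (by simp) x
    exact tendsto_nhds_unique h1 (by simp)
  add t s := by
    ext x
    obtain ⟨k, hk⟩ := h.exists_steps t
    obtain ⟨j, hj⟩ := h.exists_steps s
    -- The semigroup law is additivity of step counts, which is why `IsEulerLimit` admits every `k`
    -- with the right limit.
    have h1 := hT (t + s) (fun n => k n + j n)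
      ((hk.add hj).congr fun n => by push_cast; ring) x
    refine tendsto_nhds_unique h1 (tendsto_iff_seminorm.2 fun p hp ε hε => ?_)
    obtain ⟨q, hq, hpq, hqA⟩ := h.exists_seminorm p hp
    filter_upwards [(hq.tendsto_sub (hT s j hj x)).eventually_lt_const (half_pos hε),
      (hq.tendsto_sub (hT t k hk (T s x))).eventually_lt_const (half_pos hε)] with n hn1 hn2
    have h2 : (J n ^ (k n + j n)) x - (T t ∘ₗ T s) x =
        (J n ^ k n) ((J n ^ j n) x - T s x) + ((J n ^ k n) (T s x) - T t (T s x)) := by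
      rw [pow_add, Module.End.mul_apply, map_sub, sub_add_sub_cancel, LinearMap.comp_apply]
    rw [h2]
    have h3 := map_add_le_add q ((J n ^ k n) ((J n ^ j n) x - T s x))
      ((J n ^ k n) (T s x) - T t (T s x))
    have h4 := h.pow_seminorm_le hqA n (k n) ((J n ^ j n) x - T s x)
    exact (hpq _).trans_lt (by linarith)
  tendsto_zero x := by
    refine tendsto_iff_seminorm.2 fun p hp ε hε => ?_
    obtain ⟨q, hq, hpq, hqA⟩ := h.exists_seminorm p hp
    obtain ⟨z, hz⟩ := h.dense.exists_seminorm_sub_lt hq x (show 0 < ε / 4 by positivity)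
    have hlim : Tendsto (fun t : ℝ≥0 => (t : ℝ) * q (A z)) (𝓝[>] 0) (𝓝 0) := by
      have h1 : Continuous fun t : ℝ≥0 => (t : ℝ) * q (A z) := by fun_prop
      simpa using (h1.tendsto 0).mono_left nhdsWithin_le_nhds
    filter_upwards [hlim.eventually_lt_const (half_pos hε)] with t ht
    have h1 : T t x - x = T t (x - z) + ((T t z - z) - (x - z)) := by
      rw [map_sub]; abel
    rw [h1]
    have h2 := map_add_le_add q (T t (x - z)) ((T t z - z) - (x - z))
    have h3 := map_sub_le_add q (T t (z : X) - z) (x - z)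
    have h4 := hT.seminorm_le h hq hqA t (x - z)
    have h5 := hT.apply_sub_self_le h hq hqA t z
    exact (hpq _).trans_lt (by linarith)
  seqEquicontinuous := seqEquicontinuous_of_seminorm fun p hp => by
    obtain ⟨q, hq, hpq, hqA⟩ := h.exists_seminorm p hp
    exact ⟨q, hq, fun t x => (hpq _).trans (hT.seminorm_le h hq hqA t x)⟩

theorem tendsto_slope (hT : IsEulerLimit σ J T) (h : IsEulerScheme A σ J) (z : A.domain) :
    Tendsto (fun t : ℝ≥0 => (t : ℝ)⁻¹ • (T t (z : X) - (z : X))) (𝓝[>] 0) (𝓝 (A z)) := by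
  refine tendsto_iff_seminorm.2 fun p hp ε hε => ?_
  obtain ⟨q, hq, hpq, hqA⟩ := h.exists_seminorm p hp
  obtain ⟨w, hw⟩ := h.dense.exists_seminorm_sub_lt hq (A z) (show 0 < ε / 4 by positivity)
  have hlim : Tendsto (fun t : ℝ≥0 => (t : ℝ) * q (A w)) (𝓝[>] 0) (𝓝 0) := by
    have h1 : Continuous fun t : ℝ≥0 => (t : ℝ) * q (A w) := by fun_prop
    simpa using (h1.tendsto 0).mono_left nhdsWithin_le_nhds
  filter_upwards [hlim.eventually_lt_const (half_pos hε), self_mem_nhdsWithin] with t ht ht0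
  have ht0 : (0 : ℝ) < t := ht0
  have h1 : (t : ℝ)⁻¹ • (T t (z : X) - (z : X)) - A z =
      (t : ℝ)⁻¹ • (T t (z : X) - z - (t : ℝ) • A z) := by
    rw [smul_sub _ (T t (z : X) - z), smul_smul, inv_mul_cancel₀ ht0.ne', one_smul]
  refine (hpq _).trans_lt ?_
  rw [h1, map_smul_eq_mul, Real.norm_of_nonneg (by positivity), inv_mul_lt_iff₀ ht0]
  refine (hT.apply_sub_self_sub_le h hq hqA z w t).trans_lt (mul_lt_mul_of_pos_left ?_ ht0)
  linarith

theorem isInfinitesimalGenerator (hT : IsEulerLimit σ J T) (h : IsEulerScheme A σ J) :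
    IsInfinitesimalGenerator A T where
  tendsto_apply := hT.tendsto_slope h
  mem_domain_iff x := by
    refine ⟨fun hx => ⟨_, hT.tendsto_slope h ⟨x, hx⟩⟩, ?_⟩
    rintro ⟨y, hy⟩
    have hs := h.pos 0
    set s := σ 0
    -- If `x` has derivative `y`, this `z` makes `w = x - z` satisfy `T t w ≈ (1 + t / s) • w` for
    -- small `t`. Contractivity of `q` then forces `q w = 0`.
    obtain ⟨z, -, hz⟩ := (h.step 0).exists_eq (x - s • y)
    suffices hxz : x = z by rw [hxz]; exact z.2
    refine eq_of_forall_seminorm fun p hp => ?_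
    obtain ⟨q, hq, hpq, hqA⟩ := h.exists_seminorm p hp
    set w := x - z with hw
    have hwy : y - A z = s⁻¹ • w := by
      have : w = s • (y - A z) := by
        rw [hw, smul_sub, sub_eq_sub_iff_add_eq_add, add_comm (s • y), ← sub_eq_sub_iff_add_eq_add,
          ← hz]
      rw [this, smul_smul, inv_mul_cancel₀ hs.ne', one_smul]
    have hlim : Tendsto (fun t : ℝ≥0 => (t : ℝ)⁻¹ • (T t w - w)) (𝓝[>] 0) (𝓝 (s⁻¹ • w)) := by
      rw [← hwy]
      refine (hy.sub (hT.tendsto_slope h z)).congr fun t => ?_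
      rw [hw, map_sub, ← smul_sub]
      congr 1
      abel
    have hle : s⁻¹ * q w ≤ 0 := by
      refine ge_of_tendsto (hq.tendsto_sub hlim) ?_
      filter_upwards [self_mem_nhdsWithin] with t ht
      have ht0 : (0 : ℝ) < t := ht
      have h1 : ((t : ℝ)⁻¹ + s⁻¹) • w =
          (t : ℝ)⁻¹ • T t w - ((t : ℝ)⁻¹ • (T t w - w) - s⁻¹ • w) := by
        module
      have h2 := congrArg q h1
      rw [map_smul_eq_mul, Real.norm_of_nonneg (by positivity)] at h2
      have h3 := map_sub_le_add q ((t : ℝ)⁻¹ • T t w) ((t : ℝ)⁻¹ • (T t w - w) - s⁻¹ • w)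
      rw [map_smul_eq_mul, Real.norm_of_nonneg (by positivity)] at h3
      have h4 := mul_le_mul_of_nonneg_left (hT.seminorm_le h hq hqA t w)
        (inv_pos.2 ht0).le
      linarith
    have h5 : q w ≤ 0 := by
      by_contra hcon
      have := mul_pos (inv_pos.2 hs) (not_le.1 hcon)
      linarith
    exact le_antisymm ((hpq w).trans h5) (apply_nonneg _ _)

end IsEulerLimit

end Scheme

/-! ### Convergence of the Euler scheme and the generation theorem. -/

section Generation

variable {X : Type*} [AddCommGroup X] [Module ℝ X] [UniformSpace X] [IsUniformAddGroup X]
  [ContinuousSMul ℝ X] [LocallyConvexSpace ℝ X] [T2Space X]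

theorem IsEulerScheme.exists_isEulerLimit (hX : SeqComplete X) {A : X →ₗ.[ℝ] X} {σ : ℕ → ℝ}
    {J : ℕ → Module.End ℝ X} (h : IsEulerScheme A σ J) : ∃ T, IsEulerLimit σ J T := by
  choose k hk using h.exists_steps
  have hex : ∀ (t : ℝ≥0) (x : X), ∃ y, Tendsto (fun n => (J n ^ k t n) x) atTop (𝓝 y) := by
    intro t x
    refine hX _ (cauchySeq_of_seminorm fun p hp ε hε => ?_)
    obtain ⟨q, hq, hpq, hqA⟩ := h.exists_seminorm p hp
    obtain ⟨N, hN⟩ := h.eventually_pow_sub_pow_lt hq hqA (hk t) (hk t) x hε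
    exact ⟨N, fun m hm n hn => (hpq _).trans_lt (hN m hm n hn)⟩
  choose T hT using hex
  refine ⟨fun t => linearMapOfTendsto (T t) (fun n => J n ^ k t n)
    (tendsto_pi_nhds.2 (hT t)), fun t j hj x => tendsto_iff_seminorm.2 fun p hp ε hε => ?_⟩
  obtain ⟨q, hq, hpq, hqA⟩ := h.exists_seminorm p hp
  obtain ⟨N, hN⟩ := h.eventually_pow_sub_pow_lt hq hqA hj (hk t) x (half_pos hε)
  filter_upwards [eventually_ge_atTop N,
    (hq.tendsto_sub (hT t x)).eventually_lt_const (half_pos hε)] with n hn1 hn2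
  change p ((J n ^ j n) x - T t x) < ε
  have h1 := map_add_le_add q ((J n ^ j n) x - (J n ^ k t n) x) ((J n ^ k t n) x - T t x)
  rw [sub_add_sub_cancel] at h1
  exact (hpq _).trans_lt (by linarith [hN n hn1 n hn1])

/-- A Hille–Yosida operator on a sequentially complete space generates a semigroup. -/
theorem HilleYosidaCondition.exists_semigroup (hX : SeqComplete X) {A : X →ₗ.[ℝ] X}
    (hA : HilleYosidaCondition A) :
    ∃ T : ℝ≥0 → X →ₗ[ℝ] X, IsC0SeqEquicontinuous T ∧ IsInfinitesimalGenerator A T := by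
  obtain ⟨σ, J, h⟩ := hA.exists_isEulerScheme
  obtain ⟨T, hT⟩ := h.exists_isEulerLimit hX
  exact ⟨T, hT.isC0SeqEquicontinuous h, hT.isInfinitesimalGenerator h⟩

end Generation

end SeqSemigroup

theorem mainTheorem1 {X : Type*} [AddCommGroup X] [Module ℝ X] [UniformSpace X]
    [IsUniformAddGroup X] [ContinuousSMul ℝ X] [LocallyConvexSpace ℝ X] [T2Space X]
    (A : X →ₗ.[ℝ] X) :
    ((∃ T : ℝ≥0 → X →ₗ[ℝ] X, SeqSemigroup.IsC0SeqEquicontinuous T ∧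
        SeqSemigroup.HasLaplaceTransform T ∧ SeqSemigroup.IsInfinitesimalGenerator A T) →
      SeqSemigroup.HilleYosidaCondition A) ∧
    (SeqSemigroup.SeqComplete X →
      ((∃ T : ℝ≥0 → X →ₗ[ℝ] X, SeqSemigroup.IsC0SeqEquicontinuous T ∧
          SeqSemigroup.IsInfinitesimalGenerator A T) ↔
        SeqSemigroup.HilleYosidaCondition A)) := by
  refine ⟨?_, fun hX => ⟨?_, fun hA => hA.exists_semigroup hX⟩⟩
  · rintro ⟨T, hT, hL, hA⟩
    exact SeqSemigroup.hilleYosidaCondition_of_laplace hT hL hA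
  · rintro ⟨T, hT, hA⟩
    exact SeqSemigroup.hilleYosidaCondition_of_laplace hT (hT.hasLaplaceTransform hX) hA
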